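/- **Theorem (Liveness of Collection Formation).** *System.* There are $n$ Collector Nodes, partitioned into $c\ge 1$ clusters: the node list is permuted in any way, with $k=\lfloor n/c\rfloor$ the first $k$ nodes form cluster $0$, the next $k$ nodes cluster $1$, and so on, and the $i$-th of the fewer than $c$ leftover nodes joins cluster $i$ (counting from $0$). A transaction with hash $h$ belongs to cluster $h \bmod c$. A *collection* is a non-empty list of transaction hashes. A quorum of a cluster is a set of members holding at least $2/3$ of the stake of the cluster; a cluster is *non-Byzantine* if honest nodes hold more than $2/3$ of its stake. *Protocol of honest nodes.* An honest node broadcasts every newly received well-formed transaction of its cluster within the cluster, and each cluster runs (basic) HotStuff: phases prepare, pre-commit, commit, decide, with quorum certificates and the usual locking rule, rotating (round-robin) leaders, and a pacemaker. A node wishes to enter view $v+1$ when it has decided in view $v$ or has spent `timeout(v)` of its local time there, where `timeout(v)` $\to\infty$; it joins the wishes of nodes holding at least $1/3$ of the stake of the cluster, and it enters the highest view for which a quorum wishes. A command either appends a non-empty list of transaction hashes to the open collection or closes the (non-empty) open collection and starts a new empty one. A node votes for an append only if it has received, from a user or a cluster member, well-formed transactions of its cluster with these hashes, and the hashes are distinct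 and do not occur earlier on the branch; it votes for a close only if the open collection is non-empty; it also votes for resuming the highest certified block. An honest leader, on top of the highest certified block reported by a quorum, closes the open collection if that is non-empty and has reached the size threshold or a given time span has passed on its local clock; otherwise it appends new transactions if it has any; otherwise it resumes that block. A node that decides a block submits each newly closed collection, guaranteed by a quorum of signatures, to the Consensus Nodes. *Assumptions.* - **Network model:** time is divided into ticks $0,1,2,\dots$, and a node takes at most one step per tick; its local clock counts its steps. The network is partially synchronous: there are constants $\Delta,\Phi$, unknown to the protocol, and in each run an unknown tick $\mathrm{GST}$, such that from $\mathrm{GST}$ on every honest node takes a step in any $\Phi$ consecutive ticks, and every message sent at tick $t$ between honest nodes arrives by $\max(t,\mathrm{GST})+\Delta$ unless it is lost. Channels are authenticated, no message arrives in the tick in which it is sent, and finitely many messages and transactions are sent per tick. - **Message delivery:** for some $\varepsilon$, with probability at least $1-\varepsilon$ no message between honest nodes is lost. - **Stake distribution:** all Collector Nodes have the same stake. - **Byzantine fraction:** honest nodes control more than $2/3$ of the total stake of the Collector Nodes. Byzantine nodes may send arbitrary messages, but cannot forge the signatures of honest nodes. - **Honest behavior:** honest nodes follow the protocol and stay available (they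 take steps forever, as above). - **Workload:** for each non-Byzantine cluster, users hand to honest members of that cluster, in the course of time, well-formed transactions of that cluster with infinitely many different hashes. All assumptions but message delivery hold almost surely. *Conclusion.* With probability at least $1-\varepsilon$, collection formation always progresses: for every tick $T$ there are a tick $t>T$ and a cluster $i$ such that at tick $t$ an honest member of cluster $i$ submits to the Consensus Nodes a collection, guaranteed by a quorum of cluster $i$, that no honest member of cluster $i$ had so submitted up to tick $T$. -/

import Mathlib

open MeasureTheory Filter Topology
open scoped NNReal ENNReal

/-! ## Transactions, collections and the replicated log -/

/-- Byte strings. -/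
abbrev Bytes : Type := List UInt8

/-- A transaction as a user agent submits it to the Collector Nodes. -/
structure SignedTransaction where
  script : Bytes
  payerSignature : Bytes
  scriptSignatures : List Bytes
  referenceBlockHash : Bytes

/-- A command on which a cluster reaches consensus: append a list of transaction hashes to the
open collection, or close the open collection and start a new empty one. -/
inductive Command where
  | append (hashes : List ℕ)
  | close

/-- A node of the HotStuff block tree. Its hash pointer to the parent is idealised as the whole
branch: a block is the list of all commands from genesis, newest first, and genesis is `[]`.
"`b` extends `b'`" is the suffix relation `b' <:+ b`. -/
abbrev Block : Type := List Command

/-- The collection under construction after executing a branch. -/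
def openCollection : Block → List ℕ
  | [] => []
  | Command.append l :: b => openCollection b ++ l
  | Command.close :: _ => []

/-- The collections closed along a branch. -/
def closedCollections : Block → List (List ℕ)
  | [] => []
  | Command.append _ :: b => closedCollections b
  | Command.close :: b => openCollection b :: closedCollections b

/-- All transaction hashes that occur along a branch. -/
def loggedHashes : Block → List ℕ
  | [] => []
  | Command.append l :: b => loggedHashes b ++ l
  | Command.close :: b => loggedHashes b

/-! ## Messages -/

/-- The three voting phases of (basic) HotStuff. -/
inductive Phase where
  | prepare
  | preCommit
  | commit

def Phase.index : Phase → ℕ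
  | Phase.prepare => 0
  | Phase.preCommit => 1
  | Phase.commit => 2

/-- A quorum certificate: the aggregated signatures of `signers` on a vote
`(phase, view, block)`. -/
structure QC (n : ℕ) where
  phase : Phase
  view : ℕ
  block : Block
  signers : Finset (Fin n)

/-- The certificate of the genesis block that every node starts with. -/
def QC.genesis (n : ℕ) : QC n where
  phase := Phase.prepare
  view := 0
  block := []
  signers := ∅

/-- The messages exchanged inside a cluster.
* `tx x`: the signed transaction `x`, countersigned by the sending Collector Node;
* `wish v`: pacemaker message, the sender wants to enter a view at least `v`;
* `newView v qc`: the sender has entered view `v` and `qc` is its highest prepare certificate;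
* `proposal v b qc`: the leader of view `v` proposes block `b`, justified by `qc`;
* `vote ph v b`: a signed vote of phase `ph` in view `v` for block `b`;
* `cert qc`: the leader announces a quorum certificate; this is the pre-commit, commit or decide
  message of HotStuff, according as `qc` certifies prepare, pre-commit or commit votes. -/
inductive Msg (n : ℕ) where
  | tx (x : SignedTransaction)
  | wish (v : ℕ)
  | newView (v : ℕ) (qc : QC n)
  | proposal (v : ℕ) (b : Block) (qc : QC n)
  | vote (ph : Phase) (v : ℕ) (b : Block)
  | cert (qc : QC n)

/-- The quorum certificate inside a message, if there is one. -/
def Msg.qc? {n : ℕ} : Msg n → Option (QC n)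
  | Msg.newView _ qc => some qc
  | Msg.proposal _ _ qc => some qc
  | Msg.cert qc => some qc
  | _ => none

/-- What a Collector Node submits to the Consensus Nodes. The hash of the collection is
idealised as the collection itself, the aggregated signature as the set of its signers. -/
structure GuaranteedCollection (n : ℕ) where
  collection : List ℕ
  clusterIndex : ℕ
  signers : Finset (Fin n)

/-! ## The system -/

/-- The fixed data of a system of `n` Collector Nodes.
* `clusters`: the number `c` of clusters;
* `shuffle`: the permutation of the node list from which the clusters are cut;
* `stake`, `honest`: the stakes and the set of honest nodes;
* `txHash`: the hash of a signed transaction as an unsigned integer;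
* `payerSigValid`, `scriptSigValid`: verification of the signatures of a transaction;
* `sizeThreshold`, `timeSpan`: size, and age on the local clock, at which collections are closed;
* `timeout v`: how long, on its local clock, a node stays in view `v` without a decision before
  it wants to leave. -/
structure FlowSystem (n : ℕ) where
  clusters : ℕ
  shuffle : Equiv.Perm (Fin n)
  stake : Fin n → ℝ≥0
  honest : Finset (Fin n)
  txHash : SignedTransaction → ℕ
  payerSigValid : SignedTransaction → Prop
  scriptSigValid : SignedTransaction → Bytes → Prop
  sizeThreshold : ℕ
  timeSpan : ℕ
  timeout : ℕ → ℕ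

namespace FlowSystem

variable {n : ℕ} (F : FlowSystem n)

/-- The cluster of the node at position `j` of the shuffled list: with `k = ⌊n / c⌋`, the first
`k` nodes go to cluster `0`, the next `k` nodes to cluster `1`, and so on; the `i`-th of the
fewer than `c` leftover nodes goes to cluster `i`. -/
def clusterOfPosition (j : ℕ) : ℕ :=
  if j < F.clusters * (n / F.clusters) then j / (n / F.clusters)
  else j - F.clusters * (n / F.clusters)

/-- The cluster of a node; position `j` of the shuffled list holds node `F.shuffle j`. -/
def cluster (p : Fin n) : ℕ :=
  F.clusterOfPosition (F.shuffle.symm p)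

/-- The members of cluster `i`. -/
def members (i : ℕ) : Finset (Fin n) :=
  Finset.univ.filter fun p => F.cluster p = i

/-- The members of cluster `i` in the order of the shuffled list. -/
def memberList (i : ℕ) : List (Fin n) :=
  ((List.finRange n).map F.shuffle).filter fun p => F.cluster p = i

/-- Leaders rotate round-robin: `p` leads view `v` of cluster `i`. -/
def IsLeader (i v : ℕ) (p : Fin n) : Prop :=
  (F.memberList i)[v % (F.memberList i).length]? = some p

/-- Total stake of a set of nodes. -/
noncomputable def stakeOf (S : Finset (Fin n)) : ℝ≥0 :=
  ∑ p ∈ S, F.stake p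

/-- `S` consists of members of cluster `i` with at least `2/3` of the effective votes of the
cluster. -/
def IsQuorum (i : ℕ) (S : Finset (Fin n)) : Prop :=
  S ⊆ F.members i ∧ 2 * F.stakeOf (F.members i) ≤ 3 * F.stakeOf S

/-- `S` consists of members of cluster `i` with at least `1/3` of the effective votes. -/
def IsWeakQuorum (i : ℕ) (S : Finset (Fin n)) : Prop :=
  S ⊆ F.members i ∧ F.stakeOf (F.members i) ≤ 3 * F.stakeOf S

/-- A cluster is non-Byzantine if honest nodes hold more than `2/3` of its stake. -/
def NonByzantine (i : ℕ) : Prop :=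
  2 * F.stakeOf (F.members i) < 3 * F.stakeOf (F.members i ∩ F.honest)

/-- A transaction is well-formed if its payer signature and all its script signatures verify. -/
def WellFormed (x : SignedTransaction) : Prop :=
  F.payerSigValid x ∧ ∀ σ ∈ x.scriptSignatures, F.scriptSigValid x σ

/-- The cluster to which a transaction has to be submitted. -/
def txCluster (x : SignedTransaction) : ℕ :=
  F.txHash x % F.clusters

/-- A certificate that the members of cluster `i` accept: genesis, or signed by a quorum. -/
def ValidQC (i : ℕ) (qc : QC n) : Prop :=
  qc = QC.genesis n ∨ F.IsQuorum i qc.signers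

end FlowSystem

/-! ## The protocol of an honest Collector Node -/

/-- The local state of a Collector Node.
* `clock`: number of steps taken so far (the local processing clock);
* `view`, `entered`: the current HotStuff view and the local time at which it was entered;
* `wish`: the highest view for which the node has sent a `wish`;
* `stage`: as a replica in the current view, `0` before any vote, then `1`, `2`, `3` after the
  prepare, pre-commit, commit vote, and `4` after the decision;
* `leadStage`: as a leader in the current view, `0` while collecting `newView` messages, then
  `1`, `2`, `3` while collecting prepare, pre-commit, commit votes, and `4` when done;
* `prepareQC`, `lockedQC`: as in HotStuff;
* `log`: the decided branch; `opened`: the local time at which its open collection was started;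
* `known`: the transactions already broadcast to the cluster. -/
structure NodeState (n : ℕ) where
  clock : ℕ
  view : ℕ
  entered : ℕ
  wish : ℕ
  stage : ℕ
  leadStage : ℕ
  prepareQC : QC n
  lockedQC : QC n
  log : Block
  opened : ℕ
  known : Set SignedTransaction

/-- The initial state. View `0` is only a bootstrap view in which nothing is proposed. -/
def NodeState.init (n : ℕ) : NodeState n where
  clock := 0
  view := 0
  entered := 0
  wish := 0
  stage := 4
  leadStage := 4
  prepareQC := QC.genesis n
  lockedQC := QC.genesis n
  log := []
  opened := 0
  known := ∅

namespace FlowSystem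

/-! In this part `p` is the node that takes a step, `R` the set of all pairs (sender, message)
it has received so far, and `U` the set of all transactions it has received from user agents. -/

variable {n : ℕ} (F : FlowSystem n) (p : Fin n) (R : Set (Fin n × Msg n))
  (U : Set SignedTransaction)

/-- The well-formed transactions, submitted to the right cluster, that `p` has received from a
user agent or from a member of its cluster. -/
def knownTxs : Set SignedTransaction :=
  {x | (x ∈ U ∨ ∃ q ∈ F.members (F.cluster p), (q, Msg.tx x) ∈ R) ∧
    F.WellFormed x ∧ F.txCluster x = F.cluster p}

/-- The conditions under which `p` accepts a command on top of branch `b`. -/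
def Acceptable (b : Block) : Command → Prop
  | Command.append l => l ≠ [] ∧ l.Nodup ∧ (∀ h ∈ l, h ∉ loggedHashes b) ∧
      ∀ h ∈ l, ∃ x ∈ F.knownTxs p R U, F.txHash x = h
  | Command.close => openCollection b ≠ []

/-- Replica in the prepare phase: the leader of the current view has proposed `b`, which resumes
the certified block or puts one acceptable command on top of it, and `b` passes the HotStuff
predicate `safeNode`. -/
def CanVotePrepare (s : NodeState n) (b : Block) : Prop :=
  s.stage = 0 ∧ ∃ ldr qc, F.IsLeader (F.cluster p) s.view ldr ∧
    (ldr, Msg.proposal s.view b qc) ∈ R ∧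
    F.ValidQC (F.cluster p) qc ∧ qc.phase = Phase.prepare ∧ qc.view < s.view ∧
    (b = qc.block ∨ ∃ cmd, b = cmd :: qc.block ∧ F.Acceptable p R U qc.block cmd) ∧
    (s.lockedQC.block <:+ b ∨ s.lockedQC.view < qc.view)

/-- Replica in the later phases: the leader of the current view has announced the valid
certificate `qc` of phase `ph` of this view, and `p` has not yet gone past that phase. -/
def CanAccept (s : NodeState n) (ph : Phase) (qc : QC n) : Prop :=
  s.stage ≤ ph.index + 1 ∧ ∃ ldr, F.IsLeader (F.cluster p) s.view ldr ∧
    (ldr, Msg.cert qc) ∈ R ∧ F.ValidQC (F.cluster p) qc ∧ qc.phase = ph ∧ qc.view = s.view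

open scoped Classical in
/-- The replica part of a step: `ReplicaStep F p R U s s' vote g` says that `s` becomes `s'`, that
`vote` is sent to the leader, and that the guaranteed collections in `g` are submitted to the
Consensus Nodes. Deciding a block executes all its commands that are not yet executed. -/
inductive ReplicaStep (s : NodeState n) :
    NodeState n → Option (Phase × Block) → Set (GuaranteedCollection n) → Prop
  | votePrepare (b : Block) (h : F.CanVotePrepare p R U s b) :
      ReplicaStep s { s with stage := 1 } (some (Phase.prepare, b)) ∅
  | votePreCommit (qc : QC n) (h : F.CanAccept p R s Phase.prepare qc) :
      ReplicaStep s { s with stage := 2, prepareQC := qc }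
        (some (Phase.preCommit, qc.block)) ∅
  | voteCommit (qc : QC n) (h : F.CanAccept p R s Phase.preCommit qc) :
      ReplicaStep s { s with stage := 3, lockedQC := qc }
        (some (Phase.commit, qc.block)) ∅
  | decide (qc : QC n) (h : F.CanAccept p R s Phase.commit qc) :
      ReplicaStep s
        { s with
          stage := 4
          log := qc.block
          opened := if closedCollections qc.block = closedCollections s.log then s.opened
            else s.clock }
        none
        {g | g.collection ∈ closedCollections qc.block ∧
          g.collection ∉ closedCollections s.log ∧
          g.clusterIndex = F.cluster p ∧ g.signers = qc.signers}
  | idle (h : ¬ ∃ b, F.CanVotePrepare p R U s b) (h' : ¬ ∃ ph qc, F.CanAccept p R s ph qc) :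
      ReplicaStep s s none ∅

/-- Member `q` has sent `p` an admissible `newView` message with certificate `qc` for the
current view. -/
def NewViewFrom (s : NodeState n) (q : Fin n) (qc : QC n) : Prop :=
  q ∈ F.members (F.cluster p) ∧ (q, Msg.newView s.view qc) ∈ R ∧
    F.ValidQC (F.cluster p) qc ∧ qc.phase = Phase.prepare ∧ qc.view < s.view

open scoped Classical in
/-- `qc` is a certificate of maximal view among the `newView` messages received from a quorum. -/
def IsHighQC (s : NodeState n) (qc : QC n) : Prop :=
  F.IsQuorum (F.cluster p) (Finset.univ.filter fun q => ∃ qc', F.NewViewFrom p R s q qc') ∧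
    (∃ q, F.NewViewFrom p R s q qc) ∧
    ∀ q qc', F.NewViewFrom p R s q qc' → qc'.view ≤ qc.view

/-- On top of branch `b` an honest leader proposes to close: the open collection is non-empty, and
it has reached the size threshold or the time span has passed. -/
def ShouldClose (s : NodeState n) (b : Block) : Prop :=
  openCollection b ≠ [] ∧
    (F.sizeThreshold ≤ (openCollection b).length ∨ F.timeSpan ≤ s.clock - s.opened)

/-- The block that an honest leader may propose on top of `b`: close the open collection if it is
due; otherwise append transactions if there are any new ones; otherwise resume `b`. -/
def IsLeaderChoice (s : NodeState n) (b b' : Block) : Prop :=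
  (F.ShouldClose s b ∧ b' = Command.close :: b) ∨
  (¬ F.ShouldClose s b ∧
    ∃ l, F.Acceptable p R U b (Command.append l) ∧ b' = Command.append l :: b) ∨
  (¬ F.ShouldClose s b ∧
    (¬ ∃ l, F.Acceptable p R U b (Command.append l)) ∧ b' = b)

/-- Leader: `qc` aggregates the votes of a quorum in the phase for which `p` is collecting. -/
def CanCertify (s : NodeState n) (qc : QC n) : Prop :=
  F.IsLeader (F.cluster p) s.view p ∧ s.leadStage = qc.phase.index + 1 ∧ qc.view = s.view ∧
    F.IsQuorum (F.cluster p) qc.signers ∧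
    ∀ q ∈ qc.signers, (q, Msg.vote qc.phase qc.view qc.block) ∈ R

/-- Leader: propose `b`, justified by the highest certificate `qc`. -/
def CanPropose (s : NodeState n) (b : Block) (qc : QC n) : Prop :=
  F.IsLeader (F.cluster p) s.view p ∧ s.leadStage = 0 ∧ F.IsHighQC p R s qc ∧
    F.IsLeaderChoice p R U s qc.block b

/-- The leader part of a step: `LeaderStep F p R U s k B` says that the new leader stage is `k`
and that the messages in `B` are broadcast to the cluster. -/
inductive LeaderStep (s : NodeState n) : ℕ → Set (Msg n) → Prop
  | propose (b : Block) (qc : QC n) (h : F.CanPropose p R U s b qc) :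
      LeaderStep s 1 {Msg.proposal s.view b qc}
  | certify (qc : QC n) (h : F.CanCertify p R s qc) :
      LeaderStep s (s.leadStage + 1) {Msg.cert qc}
  | idle (h : ¬ ∃ b qc, F.CanPropose p R U s b qc) (h' : ¬ ∃ qc, F.CanCertify p R s qc) :
      LeaderStep s s.leadStage ∅

open scoped Classical in
/-- The members of the cluster of `p` from which `p` has received a wish for a view `≥ w`. -/
noncomputable def wishers (w : ℕ) : Finset (Fin n) :=
  (F.members (F.cluster p)).filter fun q => ∃ w' ≥ w, (q, Msg.wish w') ∈ R

/-- Pacemaker: `p` wishes for the next view when the current view has timed out or its decision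
has been reached, and joins the wishes of a weak quorum. -/
noncomputable def nextWish (s : NodeState n) : ℕ :=
  sSup {w | w = s.wish ∨
    (w = s.view + 1 ∧ (F.timeout s.view ≤ s.clock - s.entered ∨ s.stage = 4)) ∨
    F.IsWeakQuorum (F.cluster p) (F.wishers p R w)}

/-- Pacemaker: `p` enters the highest view for which a quorum wishes. -/
noncomputable def nextView (s : NodeState n) : ℕ :=
  sSup {w | w = s.view ∨ F.IsQuorum (F.cluster p) (F.wishers p R w)}

/-- The state after the pacemaker part of a step; entering a new view restarts the timer and the
phases. -/
noncomputable def pacemaker (s : NodeState n) : NodeState n :=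
  if s.view < F.nextView p R s then
    { s with
      wish := F.nextWish p R s
      view := F.nextView p R s
      entered := s.clock
      stage := 0
      leadStage := 0 }
  else { s with wish := F.nextWish p R s }

/-- One step of an honest node `p`, from local state `s` to `s'`: the local clock advances, then
follow the replica part, the leader part and the pacemaker part. `out q` is the set of messages
sent to node `q` and `g` the set of guaranteed collections submitted to the Consensus Nodes.
Every newly learnt transaction is broadcast to the cluster, votes go to the leader of the view,
and the leader of a newly entered view receives the highest prepare certificate. -/
def HonestStep (s s' : NodeState n) (out : Fin n → Set (Msg n))
    (g : Set (GuaranteedCollection n)) : Prop :=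
  ∃ (s₁ : NodeState n) (vote : Option (Phase × Block)) (k : ℕ) (B : Set (Msg n)),
    F.ReplicaStep p R U { s with clock := s.clock + 1 } s₁ vote g ∧
    F.LeaderStep p R U s₁ k B ∧
    s' = F.pacemaker p R { s₁ with leadStage := k, known := F.knownTxs p R U } ∧
    ∀ q, out q = {m |
      (q ∈ F.members (F.cluster p) ∧
        ((∃ x ∈ s'.known \ s.known, m = Msg.tx x) ∨ m ∈ B ∨
          (s'.wish ≠ s.wish ∧ m = Msg.wish s'.wish))) ∨
      (F.IsLeader (F.cluster p) s.view q ∧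
        ∃ ph b, vote = some (ph, b) ∧ m = Msg.vote ph s.view b) ∨
      (s'.view ≠ s.view ∧ F.IsLeader (F.cluster p) s'.view q ∧
        m = Msg.newView s'.view s'.prepareQC)}

end FlowSystem

/-! ## Runs -/

/-- The data of an infinite run in discrete real time. At tick `t`:
* `active t p`: node `p` takes a step;
* `state t p`: the local state of `p` before the tick;
* `sent t q p`: the messages that `q` sends to `p`;
* `arrival t q p m`: the tick at which the copy of `m` sent by `q` to `p` at tick `t` reaches the
  buffer of `p`, or `none` if it is lost;
* `fromUsers t p`: the transactions that user agents hand to `p`;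
* `submitted t p`: the guaranteed collections that `p` submits to the Consensus Nodes. -/
structure Run (n : ℕ) where
  active : ℕ → Fin n → Prop
  state : ℕ → Fin n → NodeState n
  sent : ℕ → Fin n → Fin n → Set (Msg n)
  arrival : ℕ → Fin n → Fin n → Msg n → Option ℕ
  fromUsers : ℕ → Fin n → Set SignedTransaction
  submitted : ℕ → Fin n → Set (GuaranteedCollection n)

namespace Run

variable {n : ℕ} (ρ : Run n) (F : FlowSystem n)

/-- Everything that has reached `p` up to tick `t`, with the authenticated sender. -/
def received (t : ℕ) (p : Fin n) : Set (Fin n × Msg n) :=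
  {x | ∃ s a, x.2 ∈ ρ.sent s x.1 p ∧ ρ.arrival s x.1 p x.2 = some a ∧ a ≤ t}

/-- The transactions that user agents have handed to `p` up to tick `t`. -/
def userTxs (t : ℕ) (p : Fin n) : Set SignedTransaction :=
  {x | ∃ s ≤ t, x ∈ ρ.fromUsers s p}

/-- Messages arrive after they are sent, and only finitely many messages are sent or handed over
in one tick. -/
def Physical : Prop :=
  (∀ t q p m a, ρ.arrival t q p m = some a → t < a) ∧
  (∀ t q p, (ρ.sent t q p).Finite) ∧ ∀ t p, (ρ.fromUsers t p).Finite

/-- Honest nodes start in the initial state and follow the protocol in each step they take. -/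
def HonestBehavior : Prop :=
  ∀ p ∈ F.honest, ρ.state 0 p = NodeState.init n ∧ ∀ t,
    (ρ.active t p → F.HonestStep p (ρ.received t p) (ρ.userTxs t p)
      (ρ.state t p) (ρ.state (t + 1) p) (ρ.sent t p) (ρ.submitted t p)) ∧
    (¬ ρ.active t p → ρ.state (t + 1) p = ρ.state t p ∧ (∀ q, ρ.sent t p q = ∅) ∧
      ρ.submitted t p = ∅)

/-- Byzantine nodes send arbitrary messages, except that they cannot forge the votes of honest
nodes: an honest signer of a certificate has sent that vote before. -/
def Unforgeable : Prop :=
  ∀ t, ∀ q ∉ F.honest, ∀ p, ∀ m ∈ ρ.sent t q p, ∀ qc, m.qc? = some qc →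
    ∀ r ∈ qc.signers, r ∈ F.honest →
      ∃ t' < t, ∃ p', Msg.vote qc.phase qc.view qc.block ∈ ρ.sent t' r p'

/-- Partial synchrony with bounds `Δ` on the message delay and `Φ` on the relative processing
speed: from some unknown tick on, every honest node takes a step in any `Φ` consecutive ticks,
and every message between honest nodes that is delivered at all arrives within `Δ` ticks of
that moment or of its sending, whichever is later. -/
def PartiallySynchronous (Δ Φ : ℕ) : Prop :=
  ∃ gst, (∀ p ∈ F.honest, ∀ t ≥ gst, ∃ t', t ≤ t' ∧ t' < t + Φ ∧ ρ.active t' p) ∧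
    ∀ t, ∀ q ∈ F.honest, ∀ p ∈ F.honest, ∀ m ∈ ρ.sent t q p, ∀ a,
      ρ.arrival t q p m = some a → a ≤ max t gst + Δ

/-- User agents keep submitting: for each non-Byzantine cluster, well-formed transactions with
infinitely many different hashes assigned to it are handed to honest members of it. -/
def KeepsSubmitting : Prop :=
  ∀ i, F.NonByzantine i →
    {h | ∃ t, ∃ p ∈ F.members i ∩ F.honest, ∃ x ∈ ρ.fromUsers t p,
      F.WellFormed x ∧ F.txCluster x = i ∧ F.txHash x = h}.Infinite

/-- The message routing loses no message between honest nodes. -/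
def AllDelivered : Prop :=
  ∀ t, ∀ q ∈ F.honest, ∀ p ∈ F.honest, ∀ m ∈ ρ.sent t q p, ρ.arrival t q p m ≠ none

/-- At tick `t` cluster `i` forms the collection `C`: an honest member submits `C` to the
Consensus Nodes, non-empty and guaranteed by at least `2/3` of the effective votes. -/
def FormsAt (t i : ℕ) (C : List ℕ) : Prop :=
  ∃ p ∈ F.members i ∩ F.honest, ∃ g ∈ ρ.submitted t p,
    g.collection = C ∧ g.clusterIndex = i ∧ C ≠ [] ∧ F.IsQuorum i g.signers

/-- Collection formation never stops: after every tick `T` some cluster forms a collection that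
it had not formed up to `T`. -/
def AlwaysProgresses : Prop :=
  ∀ T, ∃ t > T, ∃ i < F.clusters, ∃ C, ρ.FormsAt F t i C ∧ ∀ t' ≤ T, ¬ ρ.FormsAt F t' i C

end Run

/-! The argument is deterministic: in every run that satisfies the assumptions and loses no message
between honest nodes, progress holds. The probabilistic statement then follows from monotonicity of
the measure.

Since the clusters partition the nodes, averaging stakes gives a non-Byzantine cluster
(`exists_nonByzantine`), and everything else happens inside it. There two quorums always share an
honest member, and a set with a third of the stake contains one.

Safety (`Certified.suffix`): honest nodes vote once per phase and view, so certified blocks are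
unique per phase and view. By induction on views, the locking rule makes every block certified after
a decision extend the decided one.

Liveness of HotStuff (`eventually_exists_decides`): wishes spread through weak quorums, so views
grow forever and after GST honest members follow each other into a view within two rounds of `Δ + Φ`
ticks. Without a decision in view `v`, none of them wishes to leave it before `timeout v` ticks have
passed since the first entry. Time-outs grow, so they eventually leave room for the eight rounds
that an honest leader needs. Its proposal passes `safeNode` because the highest certificate reported
by a quorum is at least as recent as every honest lock (`le_view_of_isHighQC`).

Progress: late honest leaders know transactions that are not yet logged, so decided branches get
strictly longer (`exists_next_decision`). Each append adds a hash, so the open collection reaches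
the size threshold and is closed; hence the number of closed collections is unbounded
(`exists_many_closed`). Along a legal branch they are non-empty and pairwise distinct, so eventually
some decided branch contains one outside any given finite set, and the first decision of such a
collection submits it (`exists_formsAt`). -/

/-! ## Quorums and clusters -/

namespace FlowSystem

variable {n : ℕ} {F : FlowSystem n} {i : ℕ}

/-- The honest members of cluster `i`. -/
abbrev honestMembers (F : FlowSystem n) (i : ℕ) : Finset (Fin n) :=
  F.members i ∩ F.honest

theorem mem_members {p : Fin n} : p ∈ F.members i ↔ F.cluster p = i := by
  simp [members]

theorem cluster_eq_of_mem {p : Fin n} (hp : p ∈ F.honestMembers i) : F.cluster p = i :=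
  mem_members.1 (Finset.mem_inter.1 hp).1

theorem honest_of_mem {p : Fin n} (hp : p ∈ F.honestMembers i) : p ∈ F.honest :=
  (Finset.mem_inter.1 hp).2

theorem stakeOf_mono {S T : Finset (Fin n)} (h : S ⊆ T) : F.stakeOf S ≤ F.stakeOf T :=
  Finset.sum_le_sum_of_subset h

theorem stakeOf_inter_add_sdiff (S T : Finset (Fin n)) :
    F.stakeOf (S ∩ T) + F.stakeOf (S \ T) = F.stakeOf S :=
  Finset.sum_inter_add_sum_sdiff S T _

theorem IsQuorum.mono {S T : Finset (Fin n)} (h : F.IsQuorum i S) (hST : S ⊆ T)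
    (hT : T ⊆ F.members i) : F.IsQuorum i T :=
  ⟨hT, h.2.trans (mul_le_mul_right (stakeOf_mono hST) 3)⟩

theorem IsWeakQuorum.mono {S T : Finset (Fin n)} (h : F.IsWeakQuorum i S) (hST : S ⊆ T)
    (hT : T ⊆ F.members i) : F.IsWeakQuorum i T :=
  ⟨hT, h.2.trans (mul_le_mul_right (stakeOf_mono hST) 3)⟩

theorem IsQuorum.isWeakQuorum {S : Finset (Fin n)} (h : F.IsQuorum i S) : F.IsWeakQuorum i S := by
  refine ⟨h.1, le_trans ?_ h.2⟩
  rw [two_mul]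
  exact le_self_add

theorem NonByzantine.isQuorum (hN : F.NonByzantine i) : F.IsQuorum i (F.honestMembers i) :=
  ⟨Finset.inter_subset_left, hN.le⟩

/-- Byzantine members hold less than a third of the stake, too little to make up a weak quorum
alone. -/
theorem IsWeakQuorum.exists_honest (hN : F.NonByzantine i) {S : Finset (Fin n)}
    (h : F.IsWeakQuorum i S) : ∃ r ∈ S, r ∈ F.honestMembers i := by
  by_contra! hno
  have hsub : S ⊆ F.members i \ F.honest := fun r hr =>
    Finset.mem_sdiff.2 ⟨h.1 hr, fun hh => hno r hr (Finset.mem_inter.2 ⟨h.1 hr, hh⟩)⟩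
  have h1 := stakeOf_mono (F := F) hsub
  have h2 := stakeOf_inter_add_sdiff (F := F) (F.members i) F.honest
  have h3 := h.2
  have h4 : 2 * F.stakeOf (F.members i) < 3 * F.stakeOf (F.members i ∩ F.honest) := hN
  rw [← NNReal.coe_le_coe] at h1 h3
  rw [← NNReal.coe_lt_coe] at h4
  rw [← NNReal.coe_inj] at h2
  push_cast at *
  linarith

/-- Removing less than a third from at least two thirds leaves a third. So the honest part of any
quorum of wishes already makes every other honest member join. -/
theorem IsQuorum.honest_isWeakQuorum (hN : F.NonByzantine i) {S : Finset (Fin n)}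
    (h : F.IsQuorum i S) : F.IsWeakQuorum i (S ∩ F.honest) := by
  refine ⟨Finset.inter_subset_left.trans h.1, ?_⟩
  have h1 := stakeOf_mono (F := F) (Finset.sdiff_subset_sdiff h.1 (Finset.Subset.refl F.honest))
  have h2 := stakeOf_inter_add_sdiff (F := F) (F.members i) F.honest
  have h5 := stakeOf_inter_add_sdiff (F := F) S F.honest
  have h3 := h.2
  have h4 : 2 * F.stakeOf (F.members i) < 3 * F.stakeOf (F.members i ∩ F.honest) := hN
  rw [← NNReal.coe_le_coe] at h1 h3 ⊢
  rw [← NNReal.coe_lt_coe] at h4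
  rw [← NNReal.coe_inj] at h2 h5
  push_cast at *
  linarith

/-- Two sets of two thirds overlap in at least one third, and a third contains an honest member. -/
theorem IsQuorum.exists_honest_inter (hN : F.NonByzantine i) {S T : Finset (Fin n)}
    (hS : F.IsQuorum i S) (hT : F.IsQuorum i T) :
    ∃ r ∈ F.honestMembers i, r ∈ S ∧ r ∈ T := by
  have hw : F.IsWeakQuorum i (S ∩ T) := by
    refine ⟨Finset.inter_subset_left.trans hS.1, ?_⟩
    have h1 : F.stakeOf (S ∪ T) + F.stakeOf (S ∩ T) = F.stakeOf S + F.stakeOf T :=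
      Finset.sum_union_inter
    have h2 := stakeOf_mono (F := F) (Finset.union_subset hS.1 hT.1)
    have h3 := hS.2
    have h4 := hT.2
    rw [← NNReal.coe_le_coe] at h2 h3 h4 ⊢
    rw [← NNReal.coe_inj] at h1
    push_cast at *
    linarith
  obtain ⟨r, hr, hr'⟩ := hw.exists_honest hN
  exact ⟨r, hr', Finset.mem_inter.1 hr⟩

theorem IsQuorum.exists_honest (hN : F.NonByzantine i) {S : Finset (Fin n)}
    (hS : F.IsQuorum i S) : ∃ r ∈ F.honestMembers i, r ∈ S := by
  obtain ⟨r, hr, h, -⟩ := hS.exists_honest_inter hN hS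
  exact ⟨r, hr, h⟩

theorem cluster_lt (hc : 0 < F.clusters) (p : Fin n) : F.cluster p < F.clusters := by
  have hj := (F.shuffle.symm p).isLt
  unfold cluster clusterOfPosition
  split_ifs with h
  · exact Nat.div_lt_of_lt_mul (by rwa [mul_comm])
  -- A leftover position exceeds `c * (n / c)` by less than `n % c`, which is less than `c`.
  · have h1 := Nat.div_add_mod n F.clusters
    have h2 := Nat.mod_lt n hc
    omega

/-- If honest nodes held at most two thirds of each cluster, summing over the partition would give
at most two thirds of the whole. -/
theorem exists_nonByzantine (hc : 0 < F.clusters)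
    (hh : 2 * F.stakeOf Finset.univ < 3 * F.stakeOf F.honest) :
    ∃ i < F.clusters, F.NonByzantine i := by
  by_contra! hno
  have hsum : ∀ S : Finset (Fin n),
      ∑ i ∈ Finset.range F.clusters, F.stakeOf (F.members i ∩ S) = F.stakeOf S := by
    intro S
    have := Finset.sum_fiberwise_of_maps_to (s := S) (t := Finset.range F.clusters)
      (g := F.cluster) (fun p _ => Finset.mem_range.2 (cluster_lt hc p)) F.stake
    unfold stakeOf
    rw [← this]
    refine Finset.sum_congr rfl fun j _ => Finset.sum_congr ?_ fun _ _ => rfl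
    ext p
    simp [mem_members, and_comm]
  have h1 := hsum Finset.univ
  have h2 := hsum F.honest
  rw [← h1, ← h2, Finset.mul_sum, Finset.mul_sum] at hh
  refine absurd hh (not_lt.2 (Finset.sum_le_sum fun j hj => ?_))
  have := hno j (Finset.mem_range.1 hj)
  unfold NonByzantine at this
  simpa using this

theorem mem_memberList {p : Fin n} : p ∈ F.memberList i ↔ F.cluster p = i := by
  simp only [memberList, List.mem_filter, List.mem_map, List.mem_finRange, true_and,
    decide_eq_true_eq, and_iff_right_iff_imp]
  exact fun _ => ⟨F.shuffle.symm p, by simp⟩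

theorem IsLeader.unique {v : ℕ} {p q : Fin n} (h : F.IsLeader i v p) (h' : F.IsLeader i v q) :
    p = q :=
  Option.some.inj (h.symm.trans h')

theorem exists_leader_ge {p : Fin n} (hp : p ∈ F.members i) (N : ℕ) :
    ∃ v ≥ N, F.IsLeader i v p := by
  obtain ⟨k, hk, hkp⟩ := List.mem_iff_getElem.1 (mem_memberList.2 (mem_members.1 hp))
  -- Adding a multiple of the cluster size to the position of `p` keeps `p` as leader.
  refine ⟨k + (F.memberList i).length * N, ?_, ?_⟩
  · have := Nat.le_mul_of_pos_left N (show 0 < (F.memberList i).length by omega)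
    omega
  · unfold IsLeader
    rw [Nat.add_mul_mod_self_left, Nat.mod_eq_of_lt hk, List.getElem?_eq_getElem hk, hkp]

end FlowSystem

/-! ## Legal branches -/

/-- Every command of the branch is acceptable on top of the commands below it. -/
def IsLegalBranch : Block → Prop
  | [] => True
  | Command.append l :: b =>
      IsLegalBranch b ∧ l ≠ [] ∧ l.Nodup ∧ ∀ h ∈ l, h ∉ loggedHashes b
  | Command.close :: b => IsLegalBranch b ∧ openCollection b ≠ []

/-- Closing only moves the open hashes into a closed collection, so a logged hash is never lost or
duplicated. -/
theorem loggedHashes_perm (b : Block) :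
    (loggedHashes b).Perm (openCollection b ++ (closedCollections b).flatten) := by
  induction b with
  | nil => simp [loggedHashes, openCollection, closedCollections]
  | cons cmd b ih =>
    cases cmd with
    | append l =>
      simp only [loggedHashes, openCollection, closedCollections]
      refine (ih.append_right l).trans ?_
      rw [List.append_assoc, List.append_assoc]
      exact List.Perm.append_left _ List.perm_append_comm
    | close => simpa [loggedHashes, openCollection, closedCollections] using ih

theorem IsLegalBranch.nodup_loggedHashes {b : Block} (h : IsLegalBranch b) :
    (loggedHashes b).Nodup := by
  induction b with
  | nil => simp [loggedHashes]
  | cons cmd b ih =>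
    cases cmd with
    | append l =>
      simp only [loggedHashes]
      exact (ih h.1).append h.2.2.1 fun x hx hx' => h.2.2.2 x hx' hx
    | close => exact ih h.1

theorem IsLegalBranch.ne_nil_of_mem_closedCollections {b : Block} (h : IsLegalBranch b) :
    ∀ C ∈ closedCollections b, C ≠ [] := by
  induction b with
  | nil => simp [closedCollections]
  | cons cmd b ih =>
    cases cmd with
    | append l => exact ih h.1
    | close =>
      intro C hC
      rcases List.mem_cons.1 hC with rfl | hC
      · exact h.2
      · exact ih h.1 C hC

/-- Distinct logged hashes make the closed collections pairwise disjoint, and disjoint non-empty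
lists differ. -/
theorem IsLegalBranch.nodup_closedCollections {b : Block} (h : IsLegalBranch b) :
    (closedCollections b).Nodup := by
  have h1 := ((loggedHashes_perm b).nodup_iff.1 h.nodup_loggedHashes).of_append_right
  have h2 := (List.nodup_flatten.1 h1).2
  refine List.Pairwise.imp_of_mem ?_ h2
  rintro C D hC - hd rfl
  obtain ⟨x, hx⟩ := List.exists_mem_of_ne_nil C (h.ne_nil_of_mem_closedCollections C hC)
  exact hd hx hx

theorem length_closedCollections_le {b b' : Block} (h : b <:+ b') :
    (closedCollections b).length ≤ (closedCollections b').length := by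
  induction b' with
  | nil => rw [List.suffix_nil.1 h]
  | cons cmd b' ih =>
    rcases List.suffix_cons_iff.1 h with rfl | h
    · exact le_rfl
    · have := ih h
      cases cmd with
      | append l => exact this
      | close => simp only [closedCollections, List.length_cons]; omega

/-- If nothing is closed between two legal branches, then the open collection has grown by at
least one hash per command. -/
theorem IsLegalBranch.length_openCollection_le {b b' : Block} (hl : IsLegalBranch b')
    (h : b <:+ b')
    (hc : (closedCollections b').length ≤ (closedCollections b).length) :
    (openCollection b).length + b'.length ≤ (openCollection b').length + b.length := by
  induction b' with
  | nil => rw [List.suffix_nil.1 h]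
  | cons cmd b' ih =>
    rcases List.suffix_cons_iff.1 h with rfl | h'
    · exact le_rfl
    · cases cmd with
      | append l =>
        have h1 := ih hl.1 h' hc
        have h2 := List.length_pos_of_ne_nil hl.2.1
        simp only [openCollection, List.length_cons, List.length_append]
        omega
      | close =>
        have := length_closedCollections_le h'
        simp only [closedCollections, List.length_cons] at hc
        omega

/-! ## Single steps of honest nodes -/

namespace FlowSystem

variable {n : ℕ} {F : FlowSystem n} {p : Fin n} {R : Set (Fin n × Msg n)}
  {U : Set SignedTransaction} {s s₁ : NodeState n} {vote : Option (Phase × Block)}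
  {g : Set (GuaranteedCollection n)} {k : ℕ} {B : Set (Msg n)}

theorem ReplicaStep.frame (h : F.ReplicaStep p R U s s₁ vote g) :
    s₁.clock = s.clock ∧ s₁.view = s.view ∧ s₁.entered = s.entered ∧ s₁.wish = s.wish ∧
      s₁.leadStage = s.leadStage ∧ s₁.known = s.known := by
  cases h <;> exact ⟨rfl, rfl, rfl, rfl, rfl, rfl⟩

theorem ReplicaStep.stage_le (h : F.ReplicaStep p R U s s₁ vote g) : s.stage ≤ s₁.stage := by
  cases h with
  | votePrepare b h => simp [h.1]
  | votePreCommit qc h => exact h.1.trans (by simp [Phase.index])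
  | voteCommit qc h => exact h.1.trans (by simp [Phase.index])
  | decide qc h => exact h.1.trans (by simp [Phase.index])
  | idle => exact le_rfl

/-- Idling is permitted only when nothing is enabled. The step taken need not be the enabled one,
but any non-idle step raises the stage, and later arguments need only lower bounds on stages. -/
theorem ReplicaStep.stage_lt (h : F.ReplicaStep p R U s s₁ vote g)
    (hen : (∃ b, F.CanVotePrepare p R U s b) ∨ ∃ ph qc, F.CanAccept p R s ph qc) :
    s.stage < s₁.stage := by
  cases h with
  | votePrepare b h => simp [h.1]
  | votePreCommit qc h => exact h.1.trans_lt (by simp [Phase.index])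
  | voteCommit qc h => exact h.1.trans_lt (by simp [Phase.index])
  | decide qc h => exact h.1.trans_lt (by simp [Phase.index])
  | idle h h' => exact (hen.elim h h').elim

theorem ReplicaStep.stage_of_vote {ph : Phase} {b : Block}
    (h : F.ReplicaStep p R U s s₁ (some (ph, b)) g) :
    s.stage ≤ ph.index ∧ s₁.stage = ph.index + 1 := by
  cases h with
  | votePrepare b h => simp [h.1, Phase.index]
  | votePreCommit qc h => exact ⟨h.1, rfl⟩
  | voteCommit qc h => exact ⟨h.1, rfl⟩

theorem ReplicaStep.prepareQC_cases (h : F.ReplicaStep p R U s s₁ vote g) :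
    s₁.prepareQC = s.prepareQC ∨
      (F.CanAccept p R s Phase.prepare s₁.prepareQC ∧ s₁.stage = 2) := by
  cases h with
  | votePreCommit qc h => exact Or.inr ⟨h, rfl⟩
  | _ => exact Or.inl rfl

theorem ReplicaStep.lockedQC_cases (h : F.ReplicaStep p R U s s₁ vote g) :
    s₁.lockedQC = s.lockedQC ∨
      (F.CanAccept p R s Phase.preCommit s₁.lockedQC ∧ s₁.stage = 3) := by
  cases h with
  | voteCommit qc h => exact Or.inr ⟨h, rfl⟩
  | _ => exact Or.inl rfl

theorem ReplicaStep.stage_cases (h : F.ReplicaStep p R U s s₁ vote g) :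
    s₁.stage = s.stage ∨ (s.stage ≤ 3 ∧ s₁.stage = 4) ∨ ∃ ph b, vote = some (ph, b) := by
  cases h with
  | votePrepare b h => exact Or.inr (Or.inr ⟨_, _, rfl⟩)
  | votePreCommit qc h => exact Or.inr (Or.inr ⟨_, _, rfl⟩)
  | voteCommit qc h => exact Or.inr (Or.inr ⟨_, _, rfl⟩)
  | decide qc h => exact Or.inr (Or.inl ⟨h.1, rfl⟩)
  | idle => exact Or.inl rfl

theorem LeaderStep.leadStage_le (h : F.LeaderStep p R U s k B) : s.leadStage ≤ k := by
  cases h with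
  | propose b qc h => simp [h.2.1]
  | certify qc h => exact Nat.le_succ _
  | idle => exact le_rfl

theorem LeaderStep.leadStage_lt (h : F.LeaderStep p R U s k B)
    (hen : (∃ b qc, F.CanPropose p R U s b qc) ∨ ∃ qc, F.CanCertify p R s qc) :
    s.leadStage < k := by
  cases h with
  | propose b qc h => simp [h.2.1]
  | certify qc h => exact Nat.lt_succ_self _
  | idle h h' => exact (hen.elim h h').elim

theorem LeaderStep.cases (h : F.LeaderStep p R U s k B) :
    (∃ b qc, F.CanPropose p R U s b qc ∧ k = 1 ∧ B = {Msg.proposal s.view b qc}) ∨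
      (∃ qc, F.CanCertify p R s qc ∧ k = s.leadStage + 1 ∧ B = {Msg.cert qc}) ∨
      (k = s.leadStage ∧ B = ∅) := by
  cases h with
  | propose b qc h => exact Or.inl ⟨b, qc, h, rfl, rfl⟩
  | certify qc h => exact Or.inr (Or.inl ⟨qc, h, rfl, rfl⟩)
  | idle => exact Or.inr (Or.inr ⟨rfl, rfl⟩)

theorem isQuorum_nextView (h : s.view < F.nextView p R s) :
    F.IsQuorum (F.cluster p) (F.wishers p R (F.nextView p R s)) := by
  -- An unbounded supremum in `ℕ` is `0` by default, which a strict increase of the view rules out;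
  -- a bounded one is attained.
  have hbdd : BddAbove {w | w = s.view ∨ F.IsQuorum (F.cluster p) (F.wishers p R w)} := by
    by_contra hb
    unfold nextView at h
    rw [Nat.sSup_of_not_bddAbove hb] at h
    exact absurd h (Nat.not_lt_zero _)
  exact (Nat.sSup_mem ⟨s.view, Or.inl rfl⟩ hbdd).resolve_left h.ne'

end FlowSystem

namespace Run

variable {n : ℕ} {ρ : Run n} {F : FlowSystem n} {i : ℕ}

/-- At tick `t` the honest node `p` takes a step whose replica part leads to the state `s₁` and
sends `vote`, and whose leader part leads to the leader stage `k` and broadcasts `B`. -/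
structure TakesStep (ρ : Run n) (F : FlowSystem n) (t : ℕ) (p : Fin n) (s₁ : NodeState n)
    (vote : Option (Phase × Block)) (k : ℕ) (B : Set (Msg n)) : Prop where
  replica : F.ReplicaStep p (ρ.received t p) (ρ.userTxs t p)
    { ρ.state t p with clock := (ρ.state t p).clock + 1 } s₁ vote (ρ.submitted t p)
  leader : F.LeaderStep p (ρ.received t p) (ρ.userTxs t p) s₁ k B
  next : ρ.state (t + 1) p = F.pacemaker p (ρ.received t p)
    { s₁ with leadStage := k, known := F.knownTxs p (ρ.received t p) (ρ.userTxs t p) }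
  out : ∀ q, ρ.sent t p q = {m |
    (q ∈ F.members (F.cluster p) ∧
      ((∃ x ∈ (ρ.state (t + 1) p).known \ (ρ.state t p).known, m = Msg.tx x) ∨ m ∈ B ∨
        ((ρ.state (t + 1) p).wish ≠ (ρ.state t p).wish ∧
          m = Msg.wish (ρ.state (t + 1) p).wish))) ∨
    (F.IsLeader (F.cluster p) (ρ.state t p).view q ∧
      ∃ ph b, vote = some (ph, b) ∧ m = Msg.vote ph (ρ.state t p).view b) ∨
    ((ρ.state (t + 1) p).view ≠ (ρ.state t p).view ∧
      F.IsLeader (F.cluster p) (ρ.state (t + 1) p).view q ∧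
      m = Msg.newView (ρ.state (t + 1) p).view (ρ.state (t + 1) p).prepareQC)}

theorem HonestBehavior.takesStep (h : ρ.HonestBehavior F) {p : Fin n} (hp : p ∈ F.honest) {t : ℕ}
    (ha : ρ.active t p) : ∃ s₁ vote k B, ρ.TakesStep F t p s₁ vote k B := by
  obtain ⟨s₁, vote, k, B, h1, h2, h3, h4⟩ := ((h p hp).2 t).1 ha
  exact ⟨s₁, vote, k, B, h1, h2, h3, h4⟩

theorem HonestBehavior.step_or_idle (h : ρ.HonestBehavior F) {p : Fin n} (hp : p ∈ F.honest)
    (t : ℕ) : (∃ s₁ vote k B, ρ.TakesStep F t p s₁ vote k B) ∨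
      (ρ.state (t + 1) p = ρ.state t p ∧ (∀ q, ρ.sent t p q = ∅) ∧ ρ.submitted t p = ∅) := by
  by_cases ha : ρ.active t p
  · exact Or.inl (h.takesStep hp ha)
  · exact Or.inr (((h p hp).2 t).2 ha)

theorem HonestBehavior.takesStep_of_mem_sent (h : ρ.HonestBehavior F) {p : Fin n}
    (hp : p ∈ F.honest) {t : ℕ} {q : Fin n} {m : Msg n} (hm : m ∈ ρ.sent t p q) :
    ∃ s₁ vote k B, ρ.TakesStep F t p s₁ vote k B := by
  rcases h.step_or_idle hp t with h | ⟨-, h, -⟩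
  · exact h
  · rw [h] at hm
    exact hm.elim

/-! ### Effects of one honest step, and what a sent message reveals about it -/

namespace TakesStep

variable {t : ℕ} {p : Fin n} {s₁ : NodeState n} {vote : Option (Phase × Block)} {k : ℕ}
  {B : Set (Msg n)} (hs : ρ.TakesStep F t p s₁ vote k B)

include hs

theorem mid_view : s₁.view = (ρ.state t p).view := hs.replica.frame.2.1

theorem mid_leadStage : s₁.leadStage = (ρ.state t p).leadStage := hs.replica.frame.2.2.2.2.1

theorem clock : (ρ.state (t + 1) p).clock = (ρ.state t p).clock + 1 := by
  have h : s₁.clock = (ρ.state t p).clock + 1 := hs.replica.frame.1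
  rw [hs.next, ← h]
  unfold FlowSystem.pacemaker
  split_ifs <;> rfl

theorem wish : (ρ.state (t + 1) p).wish = F.nextWish p (ρ.received t p) s₁ := by
  rw [hs.next]
  unfold FlowSystem.pacemaker
  split_ifs <;> rfl

theorem prepareQC : (ρ.state (t + 1) p).prepareQC = s₁.prepareQC := by
  rw [hs.next]
  unfold FlowSystem.pacemaker
  split_ifs <;> rfl

theorem lockedQC : (ρ.state (t + 1) p).lockedQC = s₁.lockedQC := by
  rw [hs.next]
  unfold FlowSystem.pacemaker
  split_ifs <;> rfl

theorem log : (ρ.state (t + 1) p).log = s₁.log := by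
  rw [hs.next]
  unfold FlowSystem.pacemaker
  split_ifs <;> rfl

theorem known : (ρ.state (t + 1) p).known =
    F.knownTxs p (ρ.received t p) (ρ.userTxs t p) := by
  rw [hs.next]
  unfold FlowSystem.pacemaker
  split_ifs <;> rfl

theorem le_view : F.nextView p (ρ.received t p) s₁ ≤ (ρ.state (t + 1) p).view := by
  rw [hs.next]
  unfold FlowSystem.pacemaker
  split_ifs with h
  · exact le_rfl
  · exact not_lt.1 h

theorem view_cases :
    ((ρ.state (t + 1) p).view = (ρ.state t p).view ∧
      (ρ.state (t + 1) p).stage = s₁.stage ∧ (ρ.state (t + 1) p).leadStage = k ∧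
      (ρ.state (t + 1) p).entered = (ρ.state t p).entered) ∨
    ((ρ.state t p).view < (ρ.state (t + 1) p).view ∧
      F.IsQuorum (F.cluster p) (F.wishers p (ρ.received t p) (ρ.state (t + 1) p).view) ∧
      (ρ.state (t + 1) p).stage = 0 ∧ (ρ.state (t + 1) p).leadStage = 0 ∧
      (ρ.state (t + 1) p).entered = (ρ.state t p).clock + 1) := by
  rw [hs.next]
  obtain ⟨h1, h2, h3, -⟩ := hs.replica.frame
  unfold FlowSystem.pacemaker
  split_ifs with h
  · exact Or.inr ⟨h2 ▸ h, FlowSystem.isQuorum_nextView h, rfl, rfl, h1⟩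
  · exact Or.inl ⟨h2, rfl, rfl, h3⟩

theorem view_le : (ρ.state t p).view ≤ (ρ.state (t + 1) p).view := by
  rcases hs.view_cases with h | h
  · exact h.1.ge
  · exact h.1.le

theorem mem_sent_of_mem_broadcast {m : Msg n} (hm : m ∈ B) {q : Fin n}
    (hq : q ∈ F.members (F.cluster p)) : m ∈ ρ.sent t p q := by
  rw [hs.out]
  exact Or.inl ⟨hq, Or.inr (Or.inl hm)⟩

theorem stage_of_sent_vote {ph : Phase} {v : ℕ} {b : Block} {q : Fin n}
    (hm : Msg.vote ph v b ∈ ρ.sent t p q) :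
    v = (ρ.state t p).view ∧ vote = some (ph, b) := by
  rw [hs.out] at hm
  rcases hm with ⟨-, ⟨x, -, h⟩ | h | ⟨-, h⟩⟩ | ⟨-, ph', b', h, h'⟩ | ⟨-, -, h⟩
  · cases h
  · rcases hs.leader.cases with ⟨_, _, -, -, rfl⟩ | ⟨_, -, -, rfl⟩ | ⟨-, rfl⟩ <;> cases h
  · cases h
  · cases h'
    exact ⟨rfl, h⟩
  · cases h

theorem of_sent_proposal {v : ℕ} {b : Block} {qc : QC n} {q : Fin n}
    (hm : Msg.proposal v b qc ∈ ρ.sent t p q) :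
    v = (ρ.state t p).view ∧ k = 1 ∧
      F.CanPropose p (ρ.received t p) (ρ.userTxs t p) s₁ b qc ∧ B = {Msg.proposal v b qc} := by
  rw [hs.out] at hm
  rcases hm with ⟨-, ⟨x, -, h⟩ | h | ⟨-, h⟩⟩ | ⟨-, ph', b', -, h⟩ | ⟨-, -, h⟩
  · cases h
  · rcases hs.leader.cases with ⟨_, _, h1, h2, rfl⟩ | ⟨_, -, -, rfl⟩ | ⟨-, rfl⟩ <;> cases h
    exact ⟨hs.mid_view, h2, h1, rfl⟩
  · cases h
  · cases h
  · cases h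

theorem of_sent_cert {qc : QC n} {q : Fin n} (hm : Msg.cert qc ∈ ρ.sent t p q) :
    k = (ρ.state t p).leadStage + 1 ∧ F.CanCertify p (ρ.received t p) s₁ qc := by
  rw [hs.out] at hm
  rcases hm with ⟨-, ⟨x, -, h⟩ | h | ⟨-, h⟩⟩ | ⟨-, ph', b', -, h⟩ | ⟨-, -, h⟩
  · cases h
  · rcases hs.leader.cases with ⟨_, _, h1, h2, rfl⟩ | ⟨_, h1, h2, rfl⟩ | ⟨-, rfl⟩ <;> cases h
    exact ⟨hs.mid_leadStage ▸ h2, h1⟩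
  · cases h
  · cases h
  · cases h

theorem of_sent_newView {v : ℕ} {qc : QC n} {q : Fin n}
    (hm : Msg.newView v qc ∈ ρ.sent t p q) :
    v = (ρ.state (t + 1) p).view ∧ (ρ.state t p).view < v ∧
      qc = (ρ.state (t + 1) p).prepareQC := by
  rw [hs.out] at hm
  rcases hm with ⟨-, ⟨x, -, h⟩ | h | ⟨-, h⟩⟩ | ⟨-, ph', b', -, h⟩ | ⟨h', -, h⟩
  · cases h
  · rcases hs.leader.cases with ⟨_, _, -, -, rfl⟩ | ⟨_, -, -, rfl⟩ | ⟨-, rfl⟩ <;> cases h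
  · cases h
  · cases h
  · cases h
    exact ⟨rfl, lt_of_le_of_ne hs.view_le h'.symm, rfl⟩

theorem of_sent_wish {w : ℕ} {q : Fin n} (hm : Msg.wish w ∈ ρ.sent t p q) :
    w = (ρ.state (t + 1) p).wish := by
  rw [hs.out] at hm
  rcases hm with ⟨-, ⟨x, -, h⟩ | h | ⟨-, h⟩⟩ | ⟨-, ph', b', -, h⟩ | ⟨-, -, h⟩
  · cases h
  · rcases hs.leader.cases with ⟨_, _, -, -, rfl⟩ | ⟨_, -, -, rfl⟩ | ⟨-, rfl⟩ <;> cases h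
  · cases h
    rfl
  · cases h
  · cases h

end TakesStep

/-! ## Invariants of the local state -/

section Invariants

variable (hb : ρ.HonestBehavior F) {p : Fin n} (hp : p ∈ F.honest)

include hb hp

theorem view_mono : Monotone fun t => (ρ.state t p).view := by
  refine monotone_nat_of_le_succ fun t => ?_
  rcases hb.step_or_idle hp t with ⟨_, _, _, _, hs⟩ | ⟨h, -⟩
  · exact hs.view_le
  · simp only [h, le_refl]

theorem stage_succ_cases (t : ℕ) (hv : (ρ.state (t + 1) p).view = (ρ.state t p).view) :
    (ρ.state t p).stage ≤ (ρ.state (t + 1) p).stage ∧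
      (ρ.state t p).leadStage ≤ (ρ.state (t + 1) p).leadStage := by
  rcases hb.step_or_idle hp t with ⟨_, _, _, _, hs⟩ | ⟨h, -⟩
  · rcases hs.view_cases with ⟨-, h1, h2, -⟩ | ⟨h, -⟩
    · rw [h1, h2]
      exact ⟨hs.replica.stage_le, hs.mid_leadStage ▸ hs.leader.leadStage_le⟩
    · exact absurd hv h.ne'
  · simp only [h, le_refl, and_self]

/-- Views never decrease, so equal views at both ends mean that the view did not change in between
and no stage was reset. -/
theorem stage_mono {t t' : ℕ} (htt : t ≤ t')
    (hv : (ρ.state t' p).view = (ρ.state t p).view) :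
    (ρ.state t p).stage ≤ (ρ.state t' p).stage ∧
      (ρ.state t p).leadStage ≤ (ρ.state t' p).leadStage := by
  induction t', htt using Nat.le_induction with
  | base => exact ⟨le_rfl, le_rfl⟩
  | succ t' htt ih =>
    have h1 := view_mono hb hp htt
    have h2 := view_mono hb hp (Nat.le_succ t')
    simp only [Nat.succ_eq_add_one] at h1 h2
    have h3 := ih (by omega)
    have h4 := stage_succ_cases hb hp t' (by omega)
    exact ⟨h3.1.trans h4.1, h3.2.trans h4.2⟩

/-- Nobody votes or leads in the bootstrap view. Hence genuine votes have positive views and cannot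
be confused with the genesis certificate, whose view is `0`. -/
theorem stage_of_view_eq_zero (t : ℕ) (hv : (ρ.state t p).view = 0) :
    (ρ.state t p).stage = 4 ∧ (ρ.state t p).leadStage = 4 := by
  have h0 : (ρ.state 0 p).stage = 4 ∧ (ρ.state 0 p).leadStage = 4 ∧
      (ρ.state 0 p).view = 0 := by
    rw [(hb p hp).1]
    exact ⟨rfl, rfl, rfl⟩
  induction t with
  | zero => exact ⟨h0.1, h0.2.1⟩
  | succ t ih =>
    rcases hb.step_or_idle hp t with ⟨s₁, _, _, _, hs⟩ | ⟨h, -⟩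
    · rcases hs.view_cases with ⟨h, h1, h2, -⟩ | ⟨h, -⟩
      · obtain ⟨h3, h4⟩ := ih (h ▸ hv)
        rw [h1, h2]
        constructor
        · rcases hs.replica.stage_cases with h | ⟨-, h⟩ | ⟨ph, b, rfl⟩
          · exact h.trans h3
          · exact h
          · have := hs.replica.stage_of_vote.1
            simp only [h3] at this
            cases ph <;> simp [Phase.index] at this
        · rcases hs.leader.cases with ⟨_, _, h, -⟩ | ⟨qc, h, -⟩ | ⟨h, -⟩
          · have := h.2.1
            rw [hs.mid_leadStage, h4] at this
            omega
          · have := h.2.1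
            rw [hs.mid_leadStage, h4] at this
            revert this
            cases qc.phase <;> simp [Phase.index]
          · rw [h, hs.mid_leadStage, h4]
      · omega
    · rw [h] at hv ⊢
      exact ih hv

theorem clock_mono : Monotone fun t => (ρ.state t p).clock := by
  refine monotone_nat_of_le_succ fun t => ?_
  rcases hb.step_or_idle hp t with ⟨_, _, _, _, hs⟩ | ⟨h, -⟩
  · simp only [hs.clock]
    omega
  · simp only [h, le_refl]

theorem stage_le_four (t : ℕ) : (ρ.state t p).stage ≤ 4 := by
  induction t with
  | zero =>
    rw [(hb p hp).1]
    exact le_rfl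
  | succ t ih =>
    rcases hb.step_or_idle hp t with ⟨_, _, _, _, hs⟩ | ⟨h, -⟩
    · rcases hs.view_cases with ⟨-, h, -⟩ | ⟨-, -, h, -⟩
      · rw [h]
        rcases hs.replica.stage_cases with h | ⟨-, h⟩ | ⟨ph, b, rfl⟩
        · exact h.trans_le ih
        · exact h.le
        · rw [hs.replica.stage_of_vote.2]
          cases ph <;> simp [Phase.index]
      · omega
    · rw [h]
      exact ih

/-- The view and stage at which an honest vote is sent. -/
theorem sent_vote_stage {t : ℕ} {ph : Phase} {v : ℕ} {b : Block} {q : Fin n}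
    (hm : Msg.vote ph v b ∈ ρ.sent t p q) :
    (ρ.state t p).view = v ∧ (ρ.state t p).stage ≤ ph.index ∧
      ((ρ.state (t + 1) p).view = v → (ρ.state (t + 1) p).stage = ph.index + 1) := by
  obtain ⟨s₁, vote, k, B, hs⟩ := hb.takesStep_of_mem_sent hp hm
  obtain ⟨h1, rfl⟩ := hs.stage_of_sent_vote hm
  obtain ⟨h2, h3⟩ := hs.replica.stage_of_vote
  refine ⟨h1.symm, h2, fun hv => ?_⟩
  rcases hs.view_cases with h | h
  · exact h.2.1.trans h3
  · omega

theorem vote_view_pos {t : ℕ} {ph : Phase} {v : ℕ} {b : Block} {q : Fin n}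
    (hm : Msg.vote ph v b ∈ ρ.sent t p q) : 0 < v := by
  obtain ⟨h1, h2, -⟩ := sent_vote_stage hb hp hm
  refine Nat.pos_of_ne_zero fun h0 => ?_
  have := (stage_of_view_eq_zero hb hp t (h1.trans h0)).1
  rw [this] at h2
  cases ph <;> simp [Phase.index] at h2

/-- An honest node votes at most once per phase and view. -/
theorem vote_unique {t t' : ℕ} {ph : Phase} {v : ℕ} {b b' : Block} {q q' : Fin n}
    (hm : Msg.vote ph v b ∈ ρ.sent t p q) (hm' : Msg.vote ph v b' ∈ ρ.sent t' p q') :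
    b = b' := by
  wlog htt : t ≤ t' generalizing t t' b b' q q'
  · exact (this hm' hm (by omega)).symm
  obtain ⟨h1, h2, h3⟩ := sent_vote_stage hb hp hm
  obtain ⟨h1', h2', -⟩ := sent_vote_stage hb hp hm'
  rcases htt.eq_or_lt with rfl | htt
  · obtain ⟨s₁, vote, k, B, hs⟩ := hb.takesStep_of_mem_sent hp hm
    have h4 := (hs.stage_of_sent_vote hm).2
    rw [(hs.stage_of_sent_vote hm').2] at h4
    simp only [Option.some.injEq, Prod.mk.injEq, true_and] at h4
    exact h4.symm
  · have h4 := view_mono hb hp (Nat.le_succ t)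
    have h5 := view_mono hb hp (show t + 1 ≤ t' from htt)
    simp only [Nat.succ_eq_add_one] at h4 h5
    -- The first vote lifted the stage to `ph.index + 1`; a second one in the same view would need a
    -- stage of at most `ph.index`.
    have h6 := (stage_mono hb hp (show t + 1 ≤ t' from htt) (by omega)).1
    have h7 := h3 (by omega)
    omega

/-- An honest leader makes at most one proposal per view. -/
theorem proposal_unique {t t' : ℕ} {v : ℕ} {b b' : Block} {qc qc' : QC n} {q q' : Fin n}
    (hm : Msg.proposal v b qc ∈ ρ.sent t p q) (hm' : Msg.proposal v b' qc' ∈ ρ.sent t' p q') :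
    b = b' := by
  wlog htt : t ≤ t' generalizing t t' b b' q q' qc qc'
  · exact (this hm' hm (by omega)).symm
  obtain ⟨s₁, vote, k, B, hs⟩ := hb.takesStep_of_mem_sent hp hm
  obtain ⟨h1, h2, h3, h4⟩ := hs.of_sent_proposal hm
  obtain ⟨s₁', vote', k', B', hs'⟩ := hb.takesStep_of_mem_sent hp hm'
  obtain ⟨h1', h2', h3', -⟩ := hs'.of_sent_proposal hm'
  rcases htt.eq_or_lt with rfl | htt
  · have h5 := (hs.of_sent_proposal hm').2.2.2
    rw [h4] at h5
    cases Set.singleton_injective h5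
    rfl
  · have h4 := view_mono hb hp (Nat.le_succ t)
    have h5 := view_mono hb hp (show t + 1 ≤ t' from htt)
    simp only [Nat.succ_eq_add_one] at h4 h5
    have h6 := (stage_mono hb hp (show t + 1 ≤ t' from htt) (by omega)).2
    have h7 := h3'.2.1
    rw [hs'.mid_leadStage] at h7
    rcases hs.view_cases with h | h
    · omega
    · omega

end Invariants

end Run

/-! ## Certificates and safety -/

namespace FlowSystem

variable {n : ℕ} {F : FlowSystem n} {p : Fin n} {R : Set (Fin n × Msg n)}
  {U : Set SignedTransaction} {s s₁ : NodeState n} {g : Set (GuaranteedCollection n)} {b : Block}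

theorem ReplicaStep.of_vote_prepare
    (h : F.ReplicaStep p R U s s₁ (some (Phase.prepare, b)) g) : F.CanVotePrepare p R U s b := by
  cases h with
  | votePrepare b h => exact h

theorem ReplicaStep.of_vote_preCommit
    (h : F.ReplicaStep p R U s s₁ (some (Phase.preCommit, b)) g) :
    F.CanAccept p R s Phase.prepare s₁.prepareQC ∧ s₁.prepareQC.block = b := by
  cases h with
  | votePreCommit qc h => exact ⟨h, rfl⟩

theorem ReplicaStep.of_vote_commit
    (h : F.ReplicaStep p R U s s₁ (some (Phase.commit, b)) g) :
    F.CanAccept p R s Phase.preCommit s₁.lockedQC ∧ s₁.lockedQC.block = b := by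
  cases h with
  | voteCommit qc h => exact ⟨h, rfl⟩

theorem CanAccept.view_eq {ph : Phase} {qc : QC n} (h : F.CanAccept p R s ph qc) :
    qc.view = s.view := by
  obtain ⟨-, ldr, -, -, -, -, h⟩ := h
  exact h

theorem CanAccept.phase_eq {ph : Phase} {qc : QC n} (h : F.CanAccept p R s ph qc) :
    qc.phase = ph := by
  obtain ⟨-, ldr, -, -, -, h, -⟩ := h
  exact h

theorem CanAccept.validQC {ph : Phase} {qc : QC n} (h : F.CanAccept p R s ph qc) :
    F.ValidQC (F.cluster p) qc := by
  obtain ⟨-, ldr, -, -, h, -⟩ := h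
  exact h

end FlowSystem

namespace Run

variable {n : ℕ} {ρ : Run n} {F : FlowSystem n} {i : ℕ}

theorem Physical.exists_sent (h : ρ.Physical) {t : ℕ} {q p : Fin n} {m : Msg n}
    (hm : (q, m) ∈ ρ.received t p) : ∃ s < t, m ∈ ρ.sent s q p := by
  obtain ⟨s, a, h1, h2, h3⟩ := hm
  exact ⟨s, (h.1 s q p m a h2).trans_le h3, h1⟩

/-- Every honest signer of `qc` has sent the corresponding vote before tick `t`. -/
def Signed (ρ : Run n) (F : FlowSystem n) (t : ℕ) (qc : QC n) : Prop :=
  ∀ r ∈ qc.signers, r ∈ F.honest →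
    ∃ t' < t, ∃ p', Msg.vote qc.phase qc.view qc.block ∈ ρ.sent t' r p'

theorem Signed.mono {t t' : ℕ} {qc : QC n} (h : ρ.Signed F t qc) (htt : t ≤ t') :
    ρ.Signed F t' qc := fun r hr hr' => by
  obtain ⟨s, hs, h⟩ := h r hr hr'
  exact ⟨s, hs.trans_le htt, h⟩

theorem signed_genesis (t : ℕ) : ρ.Signed F t (QC.genesis n) := fun r hr => by
  simp [QC.genesis] at hr

/-- The vote `(ph, v, b)` has been cast by the honest part of a quorum of cluster `i`. -/
def Certified (ρ : Run n) (F : FlowSystem n) (i : ℕ) (ph : Phase) (v : ℕ) (b : Block) : Prop :=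
  ∃ Q, F.IsQuorum i Q ∧ ∀ r ∈ Q, r ∈ F.honest → ∃ t p', Msg.vote ph v b ∈ ρ.sent t r p'

theorem Signed.certified {t : ℕ} {qc : QC n} (h : ρ.Signed F t qc)
    (hq : F.IsQuorum i qc.signers) : ρ.Certified F i qc.phase qc.view qc.block := by
  refine ⟨_, hq, fun r hr hr' => ?_⟩
  obtain ⟨s, -, h⟩ := h r hr hr'
  exact ⟨s, h⟩

theorem Signed.eq_genesis_or_certified {t : ℕ} {qc : QC n} (h : ρ.Signed F t qc)
    (hv : F.ValidQC i qc) :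
    qc = QC.genesis n ∨ ρ.Certified F i qc.phase qc.view qc.block :=
  hv.imp_right h.certified

/-! ### Origin of certificates, the locking rule, and agreement -/

section Safety

variable (hphys : ρ.Physical) (hb : ρ.HonestBehavior F) (hu : ρ.Unforgeable F)
  (hN : F.NonByzantine i)

include hphys hb hu

/-- No certificate contains a forged vote of an honest node. -/
theorem signed_of_sent_and_state (t : ℕ) :
    (∀ q p, ∀ m ∈ ρ.sent t q p, ∀ qc, m.qc? = some qc → ρ.Signed F t qc) ∧
      ∀ q ∈ F.honest, ρ.Signed F t (ρ.state t q).prepareQC ∧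
        ρ.Signed F t (ρ.state t q).lockedQC := by
  induction t using Nat.strong_induction_on with
  | _ t ih =>
    -- No message arrives in the tick of its sending, so received certificates fall under the
    -- induction hypothesis.
    have hrec : ∀ s ≤ t, ∀ q p m qc, (q, m) ∈ ρ.received s p → m.qc? = some qc →
        ρ.Signed F s qc := by
      intro s hs q p m qc hm hqc
      obtain ⟨s', hs', hm'⟩ := hphys.exists_sent hm
      exact ((ih s' (by omega)).1 q p m hm' qc hqc).mono hs'.le
    have hstate : ∀ q ∈ F.honest, ρ.Signed F t (ρ.state t q).prepareQC ∧
        ρ.Signed F t (ρ.state t q).lockedQC := by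
      intro q hq
      cases t with
      | zero =>
        rw [(hb q hq).1]
        exact ⟨signed_genesis 0, signed_genesis 0⟩
      | succ t =>
        obtain ⟨h1, h2⟩ := (ih t (Nat.lt_succ_self t)).2 q hq
        rcases hb.step_or_idle hq t with ⟨s₁, _, _, _, hs⟩ | ⟨h, -⟩
        · rw [hs.prepareQC, hs.lockedQC]
          constructor
          · rcases hs.replica.prepareQC_cases with h | ⟨⟨-, ldr, -, h, -⟩, -⟩
            · rw [h]
              exact h1.mono t.le_succ
            · exact (hrec t t.le_succ _ _ _ _ h rfl).mono t.le_succ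
          · rcases hs.replica.lockedQC_cases with h | ⟨⟨-, ldr, -, h, -⟩, -⟩
            · rw [h]
              exact h2.mono t.le_succ
            · exact (hrec t t.le_succ _ _ _ _ h rfl).mono t.le_succ
        · rw [h]
          exact ⟨h1.mono t.le_succ, h2.mono t.le_succ⟩
    refine ⟨fun q p m hm qc hqc => ?_, hstate⟩
    by_cases hq : q ∈ F.honest
    · obtain ⟨s₁, vote, k, B, hs⟩ := hb.takesStep_of_mem_sent hq hm
      cases m with
      | tx x => cases hqc
      | wish w => cases hqc
      | vote ph v b => cases hqc
      | newView v qc' =>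
        cases hqc
        obtain ⟨-, -, h⟩ := hs.of_sent_newView hm
        rw [h, hs.prepareQC]
        rcases hs.replica.prepareQC_cases with h | ⟨⟨-, ldr, -, h, -⟩, -⟩
        · rw [h]
          exact (hstate q hq).1
        · exact hrec t le_rfl _ _ _ _ h rfl
      | proposal v b qc' =>
        cases hqc
        obtain ⟨-, -, h, -⟩ := hs.of_sent_proposal hm
        obtain ⟨-, -, ⟨-, ⟨q', -, h, -⟩, -⟩, -⟩ := h
        exact hrec t le_rfl _ _ _ _ h rfl
      | cert qc' =>
        cases hqc
        obtain ⟨-, -, -, -, -, h⟩ := hs.of_sent_cert hm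
        intro r hr _
        obtain ⟨t', ht', h'⟩ := hphys.exists_sent (h r hr)
        exact ⟨t', ht', q, h'⟩
    -- For a Byzantine sender the claim is exactly unforgeability.
    · intro r hr hr'
      exact hu t q hq p m hm qc hqc r hr hr'

theorem signed_of_received {t : ℕ} {q p : Fin n} {m : Msg n} {qc : QC n}
    (hm : (q, m) ∈ ρ.received t p) (hqc : m.qc? = some qc) : ρ.Signed F t qc := by
  obtain ⟨s, hs, hm'⟩ := hphys.exists_sent hm
  exact ((signed_of_sent_and_state hphys hb hu s).1 q p m hm' qc hqc).mono hs.le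

omit hphys hu in
-- On entering a view the stage is `0`, so the second alternative is excluded and the reported
-- certificate is strictly older than the view, as an admissible `newView` message requires.
theorem prepareQC_inv {p : Fin n} (hp : p ∈ F.honestMembers i) (t : ℕ) :
    F.ValidQC i (ρ.state t p).prepareQC ∧ (ρ.state t p).prepareQC.phase = Phase.prepare ∧
      ((ρ.state t p).prepareQC.view < (ρ.state t p).view ∨
        (ρ.state t p).prepareQC.view = (ρ.state t p).view ∧ 2 ≤ (ρ.state t p).stage) := by
  have hp' := FlowSystem.honest_of_mem hp
  induction t with
  | zero =>
    rw [(hb p hp').1]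
    exact ⟨Or.inl rfl, rfl, Or.inr ⟨rfl, by simp [NodeState.init]⟩⟩
  | succ t ih =>
    rcases hb.step_or_idle hp' t with ⟨s₁, _, _, _, hs⟩ | ⟨h, -⟩
    · rw [hs.prepareQC]
      obtain ⟨h1, h2, h3⟩ := ih
      rcases hs.replica.prepareQC_cases with h | ⟨h, h'⟩
      · rw [h]
        refine ⟨h1, h2, ?_⟩
        have h4 := hs.replica.stage_le
        rcases hs.view_cases with ⟨h5, h6, -⟩ | ⟨h5, -⟩
        · rw [h5, h6]
          exact h3.imp_right fun h7 => ⟨h7.1, h7.2.trans h4⟩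
        · left
          change (ρ.state t p).prepareQC.view < _
          omega
      · have h4 := h.view_eq
        simp only at h4
        refine ⟨FlowSystem.cluster_eq_of_mem hp ▸ h.validQC, h.phase_eq, ?_⟩
        rcases hs.view_cases with ⟨h5, h6, -⟩ | ⟨h5, -⟩
        · right
          rw [h5, h6, h']
          exact ⟨h4, le_rfl⟩
        · left
          omega
    · rw [h]
      exact ih

omit hphys hu in
-- A replica about to cast a prepare vote is in stage `0`, so its lock is strictly older than the
-- view. This makes the induction on views in `Certified.suffix` descend.
theorem lockedQC_inv {p : Fin n} (hp : p ∈ F.honestMembers i) (t : ℕ) :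
    ((ρ.state t p).lockedQC = QC.genesis n ∨ F.IsQuorum i (ρ.state t p).lockedQC.signers ∧
        (ρ.state t p).lockedQC.phase = Phase.preCommit) ∧
      ((ρ.state t p).lockedQC.view < (ρ.state t p).view ∨
        (ρ.state t p).lockedQC.view = (ρ.state t p).view ∧ 3 ≤ (ρ.state t p).stage) := by
  have hp' := FlowSystem.honest_of_mem hp
  induction t with
  | zero =>
    rw [(hb p hp').1]
    exact ⟨Or.inl rfl, Or.inr ⟨rfl, by simp [NodeState.init]⟩⟩
  | succ t ih =>
    rcases hb.step_or_idle hp' t with ⟨s₁, _, _, _, hs⟩ | ⟨h, -⟩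
    · rw [hs.lockedQC]
      obtain ⟨h1, h3⟩ := ih
      rcases hs.replica.lockedQC_cases with h | ⟨h, h'⟩
      · rw [h]
        refine ⟨h1, ?_⟩
        have h4 := hs.replica.stage_le
        rcases hs.view_cases with ⟨h5, h6, -⟩ | ⟨h5, -⟩
        · rw [h5, h6]
          exact h3.imp_right fun h7 => ⟨h7.1, h7.2.trans h4⟩
        · left
          change (ρ.state t p).lockedQC.view < _
          omega
      · have h4 := h.view_eq
        simp only at h4
        refine ⟨?_, ?_⟩
        · right
          refine ⟨(FlowSystem.cluster_eq_of_mem hp ▸ h.validQC).resolve_left fun h5 => ?_,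
            h.phase_eq⟩
          have := h.phase_eq
          rw [h5] at this
          cases this
        rcases hs.view_cases with ⟨h5, h6, -⟩ | ⟨h5, -⟩
        · right
          rw [h5, h6, h']
          exact ⟨h4, le_rfl⟩
        · left
          omega
    · rw [h]
      exact ih

omit hphys hu in
-- An accepted certificate belongs to the current view, and the one it replaces is not newer than
-- that view.
theorem prepareQC_view_mono {p : Fin n} (hp : p ∈ F.honestMembers i) :
    Monotone fun t => (ρ.state t p).prepareQC.view := by
  refine monotone_nat_of_le_succ fun t => ?_
  rcases hb.step_or_idle (FlowSystem.honest_of_mem hp) t with ⟨s₁, _, _, _, hs⟩ | ⟨h, -⟩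
  · simp only [hs.prepareQC]
    rcases hs.replica.prepareQC_cases with h | ⟨h, -⟩
    · rw [h]
    · have h1 := h.view_eq
      have h2 := (prepareQC_inv hb hp t).2.2
      simp only at h1
      omega
  · simp only [h, le_refl]

omit hphys hu in
theorem lockedQC_view_mono {p : Fin n} (hp : p ∈ F.honestMembers i) :
    Monotone fun t => (ρ.state t p).lockedQC.view := by
  refine monotone_nat_of_le_succ fun t => ?_
  rcases hb.step_or_idle (FlowSystem.honest_of_mem hp) t with ⟨s₁, _, _, _, hs⟩ | ⟨h, -⟩
  · simp only [hs.lockedQC]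
    rcases hs.replica.lockedQC_cases with h | ⟨h, -⟩
    · rw [h]
    · have h1 := h.view_eq
      have h2 := (lockedQC_inv hb hp t).2
      simp only at h1
      omega
  · simp only [h, le_refl]

omit hphys hu in
theorem sent_vote_prepare {p : Fin n} (hp : p ∈ F.honestMembers i) {t v : ℕ} {b : Block}
    {q : Fin n} (hm : Msg.vote Phase.prepare v b ∈ ρ.sent t p q) :
    (ρ.state t p).view = v ∧ (ρ.state t p).stage = 0 ∧ ∃ ldr qc, F.IsLeader i v ldr ∧
      (ldr, Msg.proposal v b qc) ∈ ρ.received t p ∧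
      F.ValidQC i qc ∧ qc.phase = Phase.prepare ∧ qc.view < v ∧
      (b = qc.block ∨ ∃ cmd, b = cmd :: qc.block ∧
        F.Acceptable p (ρ.received t p) (ρ.userTxs t p) qc.block cmd) ∧
      ((ρ.state t p).lockedQC.block <:+ b ∨ (ρ.state t p).lockedQC.view < qc.view) := by
  obtain ⟨s₁, vote, k, B, hs⟩ := hb.takesStep_of_mem_sent (FlowSystem.honest_of_mem hp) hm
  obtain ⟨rfl, rfl⟩ := hs.stage_of_sent_vote hm
  obtain ⟨h1, h2⟩ := hs.replica.of_vote_prepare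
  rw [FlowSystem.cluster_eq_of_mem hp] at h2
  exact ⟨rfl, h1, h2⟩

omit hphys hu in
theorem sent_vote_preCommit {p : Fin n} (hp : p ∈ F.honestMembers i) {t v : ℕ} {b : Block}
    {q : Fin n} (hm : Msg.vote Phase.preCommit v b ∈ ρ.sent t p q) :
    ∃ qc ldr, F.IsLeader i v ldr ∧ (ldr, Msg.cert qc) ∈ ρ.received t p ∧ F.ValidQC i qc ∧
      qc.phase = Phase.prepare ∧ qc.view = v ∧ qc.block = b ∧
      (ρ.state (t + 1) p).prepareQC = qc := by
  obtain ⟨s₁, vote, k, B, hs⟩ := hb.takesStep_of_mem_sent (FlowSystem.honest_of_mem hp) hm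
  obtain ⟨rfl, rfl⟩ := hs.stage_of_sent_vote hm
  obtain ⟨⟨-, ldr, h1, h2, h3, h4, h5⟩, h6⟩ := hs.replica.of_vote_preCommit
  rw [FlowSystem.cluster_eq_of_mem hp] at h1 h3
  exact ⟨_, ldr, h1, h2, h3, h4, h5, h6, hs.prepareQC⟩

omit hphys hu in
theorem sent_vote_commit {p : Fin n} (hp : p ∈ F.honestMembers i) {t v : ℕ} {b : Block}
    {q : Fin n} (hm : Msg.vote Phase.commit v b ∈ ρ.sent t p q) :
    ∃ qc ldr, F.IsLeader i v ldr ∧ (ldr, Msg.cert qc) ∈ ρ.received t p ∧ F.ValidQC i qc ∧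
      qc.phase = Phase.preCommit ∧ qc.view = v ∧ qc.block = b ∧
      (ρ.state (t + 1) p).lockedQC = qc := by
  obtain ⟨s₁, vote, k, B, hs⟩ := hb.takesStep_of_mem_sent (FlowSystem.honest_of_mem hp) hm
  obtain ⟨rfl, rfl⟩ := hs.stage_of_sent_vote hm
  obtain ⟨⟨-, ldr, h1, h2, h3, h4, h5⟩, h6⟩ := hs.replica.of_vote_commit
  rw [FlowSystem.cluster_eq_of_mem hp] at h1 h3
  exact ⟨_, ldr, h1, h2, h3, h4, h5, h6, hs.lockedQC⟩

include hN

omit hphys hb hu in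
theorem Certified.exists_vote {ph : Phase} {v : ℕ} {b : Block} (h : ρ.Certified F i ph v b) :
    ∃ r ∈ F.honestMembers i, ∃ t p', Msg.vote ph v b ∈ ρ.sent t r p' := by
  obtain ⟨Q, hQ, h⟩ := h
  obtain ⟨r, hr, hrQ⟩ := hQ.exists_honest hN
  exact ⟨r, hr, h r hrQ (FlowSystem.honest_of_mem hr)⟩

omit hphys hu in
theorem Certified.view_pos {ph : Phase} {v : ℕ} {b : Block} (h : ρ.Certified F i ph v b) :
    0 < v := by
  obtain ⟨r, hr, t, p', hm⟩ := h.exists_vote hN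
  exact vote_view_pos hb (FlowSystem.honest_of_mem hr) hm

omit hphys hu in
-- The two quorums share an honest voter, who votes only once per phase and view.
theorem Certified.unique {ph : Phase} {v : ℕ} {b b' : Block} (h : ρ.Certified F i ph v b)
    (h' : ρ.Certified F i ph v b') : b = b' := by
  obtain ⟨Q, hQ, h⟩ := h
  obtain ⟨Q', hQ', h'⟩ := h'
  obtain ⟨r, hr, hrQ, hrQ'⟩ := hQ.exists_honest_inter hN hQ'
  have hr' := FlowSystem.honest_of_mem hr
  obtain ⟨t, q, hm⟩ := h r hrQ hr'
  obtain ⟨t', q', hm'⟩ := h' r hrQ' hr'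
  exact vote_unique hb hr' hm hm'

omit hN in
-- A pre-commit vote answers a prepare certificate of the same view. It is not genesis, because
-- votes occur only in positive views.
theorem certified_prepare_of_vote {p : Fin n} (hp : p ∈ F.honestMembers i) {t v : ℕ} {b : Block}
    {q : Fin n} (hm : Msg.vote Phase.preCommit v b ∈ ρ.sent t p q) :
    ρ.Certified F i Phase.prepare v b := by
  obtain ⟨qc, ldr, -, h1, h2, h3, rfl, rfl, -⟩ := sent_vote_preCommit hb hp hm
  have h4 := (signed_of_received hphys hb hu h1 rfl).eq_genesis_or_certified h2
  rw [h3] at h4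
  refine h4.resolve_left fun h5 => ?_
  have h6 := vote_view_pos hb (FlowSystem.honest_of_mem hp) hm
  rw [h5] at h6
  exact absurd h6 (lt_irrefl 0)

omit hN in
theorem certified_preCommit_of_vote {p : Fin n} (hp : p ∈ F.honestMembers i) {t v : ℕ}
    {b : Block} {q : Fin n} (hm : Msg.vote Phase.commit v b ∈ ρ.sent t p q) :
    ρ.Certified F i Phase.preCommit v b := by
  obtain ⟨qc, ldr, -, h1, h2, h3, rfl, rfl, -⟩ := sent_vote_commit hb hp hm
  have h4 := (signed_of_received hphys hb hu h1 rfl).eq_genesis_or_certified h2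
  rw [h3] at h4
  refine h4.resolve_left fun h5 => ?_
  have h6 := vote_view_pos hb (FlowSystem.honest_of_mem hp) hm
  rw [h5] at h6
  exact absurd h6 (lt_irrefl 0)

theorem Certified.prepare {v : ℕ} {b : Block} (h : ρ.Certified F i Phase.preCommit v b) :
    ρ.Certified F i Phase.prepare v b := by
  obtain ⟨r, hr, t, p', hm⟩ := h.exists_vote hN
  exact certified_prepare_of_vote hphys hb hu hr hm

theorem Certified.preCommit {v : ℕ} {b : Block} (h : ρ.Certified F i Phase.commit v b) :
    ρ.Certified F i Phase.preCommit v b := by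
  obtain ⟨r, hr, t, p', hm⟩ := h.exists_vote hN
  exact certified_preCommit_of_vote hphys hb hu hr hm

/-- Certified blocks are legal branches. -/
theorem Certified.isLegalBranch {v : ℕ} {b : Block} (h : ρ.Certified F i Phase.prepare v b) :
    IsLegalBranch b := by
  induction v using Nat.strong_induction_on generalizing b with
  | _ v ih =>
    obtain ⟨r, hr, t, p', hm⟩ := h.exists_vote hN
    obtain ⟨-, -, ldr, qc, -, h1, h2, h3, h4, h5, -⟩ := sent_vote_prepare hb hr hm
    have h6 : IsLegalBranch qc.block := by
      rcases (signed_of_received hphys hb hu h1 rfl).eq_genesis_or_certified h2 with h | h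
      · rw [h]
        trivial
      · rw [h3] at h
        exact ih _ h4 h
    rcases h5 with rfl | ⟨cmd, rfl, h5⟩
    · exact h6
    · cases cmd with
      | append l => exact ⟨h6, h5.1, h5.2.1, h5.2.2.1⟩
      | close => exact ⟨h6, h5⟩

omit hN in
/-- The lock of an honest node is genesis or a certified block. -/
theorem lockedQC_certified {p : Fin n} (hp : p ∈ F.honestMembers i) (t : ℕ) :
    (ρ.state t p).lockedQC = QC.genesis n ∨
      ρ.Certified F i Phase.preCommit (ρ.state t p).lockedQC.view (ρ.state t p).lockedQC.block := by
  refine (lockedQC_inv hb hp t).1.imp_right fun h => ?_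
  have := ((signed_of_sent_and_state hphys hb hu t).2 p (FlowSystem.honest_of_mem hp)).2.certified
    h.1
  rwa [h.2] at this

/-- Safety: every block certified after a decided block extends it. -/
theorem Certified.suffix {v v' : ℕ} {b b' : Block} (h : ρ.Certified F i Phase.commit v b)
    (hvv : v ≤ v') (h' : ρ.Certified F i Phase.prepare v' b') : b <:+ b' := by
  induction v' using Nat.strong_induction_on generalizing b' with
  | _ v' ih =>
    have hprep := (h.preCommit hphys hb hu hN).prepare hphys hb hu hN
    rcases hvv.eq_or_lt with rfl | hvv
    · rw [hprep.unique hb hN h']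
    obtain ⟨Q, hQ, hc⟩ := h
    obtain ⟨Q', hQ', hc'⟩ := h'
    obtain ⟨r, hr, hrQ, hrQ'⟩ := hQ.exists_honest_inter hN hQ'
    have hr' := FlowSystem.honest_of_mem hr
    obtain ⟨t, q, hm⟩ := hc r hrQ hr'
    obtain ⟨t', q', hm'⟩ := hc' r hrQ' hr'
    obtain ⟨hv, -, -⟩ := sent_vote_stage hb hr' hm
    obtain ⟨lk, -, -, -, -, -, hlk, -, hlk'⟩ := sent_vote_commit hb hr hm
    obtain ⟨hv', hst, ldr, qc, -, h1, h2, h3, h4, h5, h6⟩ := sent_vote_prepare hb hr hm'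
    -- The shared member `r` cast its commit vote for `b` in an earlier view than its prepare vote
    -- for `b'`. Since then its lock has had view at least `v`, but still below `v'`.
    have htt : t < t' := by
      by_contra htt
      have := view_mono hb hr' (not_lt.1 htt)
      simp only at this
      omega
    have hle : v ≤ (ρ.state t' r).lockedQC.view := by
      have := lockedQC_view_mono hb hr (show t + 1 ≤ t' from htt)
      simp only [hlk', hlk] at this
      exact this
    have hlt : (ρ.state t' r).lockedQC.view < v' := by
      have := (lockedQC_inv hb hr t').2
      omega
    -- Either `b'` extends the lock of `r`, or its justification is newer than that lock. In both
    -- cases a block certified in a view of `[v, v')` lies below `b'`, and the induction applies to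
    -- it.
    rcases h6 with h6 | h6
    · refine List.IsSuffix.trans ?_ h6
      have hpos := hprep.view_pos hb hN
      have h7 := (lockedQC_certified hphys hb hu hr t').resolve_left fun h8 => by
        rw [h8] at hle
        simp only [QC.genesis] at hle
        omega
      exact ih _ hlt hle (h7.prepare hphys hb hu hN)
    · have h7 : b <:+ qc.block := by
        have h8 := ((signed_of_received hphys hb hu h1 rfl).eq_genesis_or_certified
          h2).resolve_left fun h8 => by
            rw [h8] at h6
            simp only [QC.genesis] at h6
            omega
        rw [h3] at h8
        exact ih _ h4 (by omega) h8
      rcases h5 with rfl | ⟨cmd, rfl, -⟩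
      · exact h7
      · exact h7.trans (List.suffix_cons _ _)

omit hu in
/-- The highest certificate reported by a quorum is at least as recent as every lock. -/
theorem le_view_of_isHighQC {p : Fin n} (hp : p ∈ F.honestMembers i) {t u : ℕ} {b : Block}
    (hc : ρ.Certified F i Phase.preCommit u b) {s : NodeState n} (hus : u < s.view) {qc : QC n}
    (hq : F.IsHighQC p (ρ.received t p) s qc) : u ≤ qc.view := by
  obtain ⟨hQ, -, hmax⟩ := hq
  rw [FlowSystem.cluster_eq_of_mem hp] at hQ
  obtain ⟨Q', hQ', hc'⟩ := hc
  obtain ⟨r, hr, hrQ, hrQ'⟩ := hQ.exists_honest_inter hN hQ'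
  have hr' := FlowSystem.honest_of_mem hr
  simp only [Finset.mem_filter, Finset.mem_univ, true_and] at hrQ
  obtain ⟨qc', hnv⟩ := hrQ
  refine le_trans ?_ (hmax r qc' hnv)
  obtain ⟨t₁, q₁, hm₁⟩ := hc' r hrQ' hr'
  obtain ⟨-, hnv, -⟩ := hnv
  obtain ⟨t₂, -, hm₂⟩ := hphys.exists_sent hnv
  obtain ⟨s₁, vote, k, B, hs⟩ := hb.takesStep_of_mem_sent hr' hm₂
  obtain ⟨h1, h2, h3⟩ := hs.of_sent_newView hm₂
  obtain ⟨hv, -, -⟩ := sent_vote_stage hb hr' hm₁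
  obtain ⟨pq, -, -, -, -, -, hpq, -, hpq'⟩ := sent_vote_preCommit hb hr hm₁
  -- `r` reported on entering a view above `u`, hence not before its pre-commit vote in view `u`; by
  -- then its prepare certificate had view at least `u`.
  have htt : t₁ ≤ t₂ := by
    by_contra htt
    have := view_mono hb hr' (show t₂ + 1 ≤ t₁ by omega)
    simp only at this
    omega
  have := prepareQC_view_mono hb hr (show t₁ + 1 ≤ t₂ + 1 by omega)
  simp only [hpq', hpq] at this
  rw [h3]
  exact this

end Safety

end Run

/-! ## Decisions -/

namespace FlowSystem

variable {n : ℕ} {F : FlowSystem n} {p : Fin n} {R : Set (Fin n × Msg n)}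
  {U : Set SignedTransaction} {s s₁ : NodeState n} {vote : Option (Phase × Block)}
  {g : Set (GuaranteedCollection n)}

theorem ReplicaStep.cases_decide (h : F.ReplicaStep p R U s s₁ vote g) :
    (∃ qc, F.CanAccept p R s Phase.commit qc ∧ s₁.log = qc.block ∧
      g = {g | g.collection ∈ closedCollections qc.block ∧
          g.collection ∉ closedCollections s.log ∧
          g.clusterIndex = F.cluster p ∧ g.signers = qc.signers}) ∨
      (s₁.log = s.log ∧ g = ∅ ∧ (s₁.stage = 4 → s.stage = 4)) := by
  cases h with
  | votePrepare b h => exact Or.inr ⟨rfl, rfl, by simp⟩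
  | votePreCommit qc h => exact Or.inr ⟨rfl, rfl, by simp⟩
  | voteCommit qc h => exact Or.inr ⟨rfl, rfl, by simp⟩
  | decide qc h => exact Or.inl ⟨qc, h, rfl, rfl⟩
  | idle => exact Or.inr ⟨rfl, rfl, id⟩

theorem wishers_subset {w : ℕ} : F.wishers p R w ⊆ F.members (F.cluster p) := by
  classical
  unfold wishers
  exact Finset.filter_subset _ _

end FlowSystem

namespace Run

variable {n : ℕ} {ρ : Run n} {F : FlowSystem n} {i : ℕ}

/-- At tick `t` the node `p` decides the block certified by `qc`. -/
structure Decides (ρ : Run n) (F : FlowSystem n) (t : ℕ) (p : Fin n) (qc : QC n) : Prop where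
  canAccept : F.CanAccept p (ρ.received t p)
    { ρ.state t p with clock := (ρ.state t p).clock + 1 } Phase.commit qc
  log : (ρ.state (t + 1) p).log = qc.block
  submitted : ρ.submitted t p = {g | g.collection ∈ closedCollections qc.block ∧
    g.collection ∉ closedCollections (ρ.state t p).log ∧
    g.clusterIndex = F.cluster p ∧ g.signers = qc.signers}

theorem Decides.view_eq {t : ℕ} {p : Fin n} {qc : QC n} (h : ρ.Decides F t p qc) :
    qc.view = (ρ.state t p).view :=
  h.canAccept.view_eq

theorem TakesStep.cases_decides {t : ℕ} {p : Fin n} {s₁ : NodeState n}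
    {vote : Option (Phase × Block)} {k : ℕ} {B : Set (Msg n)}
    (hs : ρ.TakesStep F t p s₁ vote k B) :
    (∃ qc, ρ.Decides F t p qc) ∨
      ((ρ.state (t + 1) p).log = (ρ.state t p).log ∧ ρ.submitted t p = ∅ ∧
        (s₁.stage = 4 → (ρ.state t p).stage = 4)) := by
  rcases hs.replica.cases_decide with ⟨qc, h1, h2, h3⟩ | ⟨h1, h2, h3⟩
  · exact Or.inl ⟨qc, h1, hs.log.trans h2, h3⟩
  · exact Or.inr ⟨hs.log.trans h1, h2, h3⟩

/-- Every positive view is entered in stage `0`, and only a decision leads to stage `4`. -/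
theorem exists_decides_of_stage (hb : ρ.HonestBehavior F) {p : Fin n} (hp : p ∈ F.honest) (t : ℕ)
    (hv : 0 < (ρ.state t p).view) (hst : (ρ.state t p).stage = 4) :
    ∃ s < t, ∃ qc, ρ.Decides F s p qc ∧ qc.view = (ρ.state t p).view := by
  induction t with
  | zero =>
    rw [(hb p hp).1] at hv
    exact absurd hv (lt_irrefl 0)
  | succ t ih =>
    rcases hb.step_or_idle hp t with ⟨s₁, _, _, _, hs⟩ | ⟨h, -⟩
    · rcases hs.view_cases with ⟨h1, h2, -⟩ | ⟨-, -, h, -⟩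
      · rcases hs.cases_decides with ⟨qc, h⟩ | ⟨-, -, h⟩
        · exact ⟨t, Nat.lt_succ_self t, qc, h, h.view_eq.trans h1.symm⟩
        · obtain ⟨s, h3, qc, h4, h5⟩ := ih (h1 ▸ hv) (h (h2.symm.trans hst))
          exact ⟨s, h3.trans (Nat.lt_succ_self t), qc, h4, h5.trans h1.symm⟩
      · omega
    · rw [h] at hv hst ⊢
      obtain ⟨s, h3, h4⟩ := ih hv hst
      exact ⟨s, h3.trans (Nat.lt_succ_self t), h4⟩

/-! ## The pacemaker -/

/-- From tick `gst` on honest nodes take steps in any `Φ` consecutive ticks and messages between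
honest nodes arrive within `Δ` ticks. -/
structure Timely (ρ : Run n) (F : FlowSystem n) (gst Δ Φ : ℕ) : Prop where
  active : ∀ p ∈ F.honest, ∀ t ≥ gst, ∃ t', t ≤ t' ∧ t' < t + Φ ∧ ρ.active t' p
  received : ∀ t t', ∀ q ∈ F.honest, ∀ p ∈ F.honest, ∀ m ∈ ρ.sent t q p,
    t + Δ ≤ t' → gst + Δ ≤ t' → (q, m) ∈ ρ.received t' p

theorem PartiallySynchronous.exists_timely {Δ Φ : ℕ} (h : ρ.PartiallySynchronous F Δ Φ)
    (hd : ρ.AllDelivered F) : ∃ gst, ρ.Timely F gst Δ Φ := by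
  obtain ⟨gst, h1, h2⟩ := h
  refine ⟨gst, h1, fun t t' q hq p hp m hm h3 h4 => ?_⟩
  obtain ⟨a, ha⟩ := Option.ne_none_iff_exists'.1 (hd t q hq p hp m hm)
  refine ⟨t, a, hm, ha, (h2 t q hq p hp m hm a ha).trans ?_⟩
  omega

section Pacemaker

variable (hphys : ρ.Physical) (hb : ρ.HonestBehavior F) (hN : F.NonByzantine i)

include hphys hb

theorem wish_of_mem_wishers {p r : Fin n} (hr : r ∈ F.honest) {t w : ℕ}
    (h : r ∈ F.wishers p (ρ.received t p) w) : ∃ s < t, w ≤ (ρ.state (s + 1) r).wish := by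
  simp only [FlowSystem.wishers, Finset.mem_filter] at h
  obtain ⟨-, w', hw, h⟩ := h
  obtain ⟨s, hs, hm⟩ := hphys.exists_sent h
  obtain ⟨s₁, vote, k, B, hst⟩ := hb.takesStep_of_mem_sent hr hm
  exact ⟨s, hs, hst.of_sent_wish hm ▸ hw⟩

include hN

/-- A weak quorum contains an honest wisher, and honest wishes before tick `t` are bounded. So
Byzantine wishes cannot make the suprema of the pacemaker collapse to the default `0`. -/
theorem bddAbove_wishers (p : Fin n) (t : ℕ) :
    BddAbove {w | F.IsWeakQuorum i (F.wishers p (ρ.received t p) w)} := by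
  refine ⟨Finset.univ.sup fun r => (Finset.range t).sup fun s => (ρ.state (s + 1) r).wish, ?_⟩
  intro w hw
  obtain ⟨r, hr, hr'⟩ := hw.exists_honest hN
  obtain ⟨s, hs, h⟩ := wish_of_mem_wishers hphys hb (FlowSystem.honest_of_mem hr') hr
  exact h.trans ((Finset.le_sup (f := fun s => (ρ.state (s + 1) r).wish)
    (Finset.mem_range.2 hs)).trans (Finset.le_sup
      (f := fun r => (Finset.range t).sup fun s => (ρ.state (s + 1) r).wish)
      (Finset.mem_univ r)))

theorem bddAbove_nextWish {p : Fin n} (hp : p ∈ F.honestMembers i) (t : ℕ) (s : NodeState n) :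
    BddAbove {w | w = s.wish ∨
      (w = s.view + 1 ∧ (F.timeout s.view ≤ s.clock - s.entered ∨ s.stage = 4)) ∨
      F.IsWeakQuorum (F.cluster p) (F.wishers p (ρ.received t p) w)} := by
  obtain ⟨M, hM⟩ := bddAbove_wishers hphys hb hN p t
  refine ⟨max M (max s.wish (s.view + 1)), ?_⟩
  rintro w (rfl | ⟨rfl, -⟩ | h)
  · simp
  · simp
  · rw [FlowSystem.cluster_eq_of_mem hp] at h
    exact (hM h).trans (le_max_left _ _)

theorem bddAbove_nextView {p : Fin n} (hp : p ∈ F.honestMembers i) (t : ℕ) (s : NodeState n) :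
    BddAbove {w | w = s.view ∨
      F.IsQuorum (F.cluster p) (F.wishers p (ρ.received t p) w)} := by
  obtain ⟨M, hM⟩ := bddAbove_wishers hphys hb hN p t
  refine ⟨max M s.view, ?_⟩
  rintro w (rfl | h)
  · simp
  · rw [FlowSystem.cluster_eq_of_mem hp] at h
    exact (hM h.isWeakQuorum).trans (le_max_left _ _)

section Step

variable {t : ℕ} {p : Fin n} {s₁ : NodeState n} {vote : Option (Phase × Block)} {k : ℕ}
  {B : Set (Msg n)} (hs : ρ.TakesStep F t p s₁ vote k B) (hp : p ∈ F.honestMembers i)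

include hs hp

theorem TakesStep.wish_cases :
    (ρ.state (t + 1) p).wish = (ρ.state t p).wish ∨
      ((ρ.state (t + 1) p).wish = (ρ.state t p).view + 1 ∧
        (F.timeout (ρ.state t p).view ≤ (ρ.state t p).clock + 1 - (ρ.state t p).entered ∨
          s₁.stage = 4)) ∨
      F.IsWeakQuorum i (F.wishers p (ρ.received t p) (ρ.state (t + 1) p).wish) := by
  have h := Nat.sSup_mem ⟨s₁.wish, Or.inl rfl⟩ (bddAbove_nextWish hphys hb hN hp t s₁)
  obtain ⟨h1, h2, h3, h4, -⟩ := hs.replica.frame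
  simp only at h1 h2 h3 h4
  rw [hs.wish]
  simp only [Set.mem_ofPred_eq, h1, h2, h3, h4] at h
  rw [FlowSystem.cluster_eq_of_mem hp] at h
  unfold FlowSystem.nextWish
  rw [FlowSystem.cluster_eq_of_mem hp, h1, h2, h3, h4]
  exact h

theorem TakesStep.le_wish {w : ℕ}
    (h : w = (ρ.state t p).wish ∨
      (w = (ρ.state t p).view + 1 ∧
        (F.timeout (ρ.state t p).view ≤ (ρ.state t p).clock + 1 - (ρ.state t p).entered ∨
          s₁.stage = 4)) ∨
      F.IsWeakQuorum i (F.wishers p (ρ.received t p) w)) : w ≤ (ρ.state (t + 1) p).wish := by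
  rw [hs.wish]
  refine le_csSup (bddAbove_nextWish hphys hb hN hp t s₁) ?_
  obtain ⟨h1, h2, h3, h4, -⟩ := hs.replica.frame
  simp only at h1 h2 h3 h4
  simp only [Set.mem_ofPred_eq, h1, h2, h3, h4]
  rwa [FlowSystem.cluster_eq_of_mem hp]

theorem TakesStep.le_view_of_isQuorum {w : ℕ}
    (h : F.IsQuorum i (F.wishers p (ρ.received t p) w)) : w ≤ (ρ.state (t + 1) p).view := by
  refine le_trans ?_ hs.le_view
  refine le_csSup (bddAbove_nextView hphys hb hN hp t s₁) (Or.inr ?_)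
  rwa [FlowSystem.cluster_eq_of_mem hp]

end Step

theorem wish_mono {p : Fin n} (hp : p ∈ F.honestMembers i) :
    Monotone fun t => (ρ.state t p).wish := by
  refine monotone_nat_of_le_succ fun t => ?_
  rcases hb.step_or_idle (FlowSystem.honest_of_mem hp) t with ⟨_, _, _, _, hs⟩ | ⟨h, -⟩
  · exact hs.le_wish hphys hb hN hp (Or.inl rfl)
  · simp only [h, le_refl]

/-- The quorum that lets a node enter a view is also a weak quorum, whose wish the node joins in the
same step. -/
theorem view_le_wish {p : Fin n} (hp : p ∈ F.honestMembers i) (t : ℕ) :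
    (ρ.state t p).view ≤ (ρ.state t p).wish := by
  have hp' := FlowSystem.honest_of_mem hp
  induction t with
  | zero =>
    rw [(hb p hp').1]
    exact le_rfl
  | succ t ih =>
    rcases hb.step_or_idle hp' t with ⟨_, _, _, _, hs⟩ | ⟨h, -⟩
    · rcases hs.view_cases with ⟨h, -⟩ | ⟨-, h, -⟩
      · exact h.le.trans (ih.trans (wish_mono hphys hb hN hp t.le_succ))
      · rw [FlowSystem.cluster_eq_of_mem hp] at h
        exact hs.le_wish hphys hb hN hp (Or.inr (Or.inr h.isWeakQuorum))
    · rw [h]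
      exact ih

omit hphys hN in
-- Each change of the wish is broadcast; only the initial wish `0` was never sent.
theorem exists_sent_wish {p : Fin n} (hp : p ∈ F.honestMembers i) (t : ℕ)
    (hw : 0 < (ρ.state t p).wish) :
    ∃ s < t, ∀ q ∈ F.members i, Msg.wish (ρ.state t p).wish ∈ ρ.sent s p q := by
  have hp' := FlowSystem.honest_of_mem hp
  induction t with
  | zero =>
    rw [(hb p hp').1] at hw
    exact absurd hw (lt_irrefl 0)
  | succ t ih =>
    by_cases heq : (ρ.state (t + 1) p).wish = (ρ.state t p).wish
    · rw [heq] at hw ⊢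
      obtain ⟨s, hs, h⟩ := ih hw
      exact ⟨s, hs.trans (Nat.lt_succ_self t), h⟩
    · rcases hb.step_or_idle hp' t with ⟨_, _, _, _, hs⟩ | ⟨h, -⟩
      · refine ⟨t, Nat.lt_succ_self t, fun q hq => ?_⟩
        rw [hs.out]
        exact Or.inl ⟨by rwa [FlowSystem.cluster_eq_of_mem hp], Or.inr (Or.inr ⟨heq, rfl⟩)⟩
      · exact absurd (by rw [h]) heq

/-- A view is entered only if a weak quorum of honest members wishes for it. -/
theorem exists_weakQuorum_wish {p : Fin n} (hp : p ∈ F.honestMembers i) (t : ℕ)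
    (hv : 0 < (ρ.state t p).view) :
    ∃ Q, F.IsWeakQuorum i Q ∧ ∀ q ∈ Q, q ∈ F.honestMembers i ∧
      (ρ.state t p).view ≤ (ρ.state t q).wish := by
  have hp' := FlowSystem.honest_of_mem hp
  induction t with
  | zero =>
    rw [(hb p hp').1] at hv
    exact absurd hv (lt_irrefl 0)
  | succ t ih =>
    have hsame : (ρ.state (t + 1) p).view = (ρ.state t p).view → ∃ Q, F.IsWeakQuorum i Q ∧
        ∀ q ∈ Q, q ∈ F.honestMembers i ∧
          (ρ.state (t + 1) p).view ≤ (ρ.state (t + 1) q).wish := by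
      intro h
      rw [h] at hv ⊢
      obtain ⟨Q, hQ, h1⟩ := ih hv
      exact ⟨Q, hQ, fun q hq => ⟨(h1 q hq).1,
        (h1 q hq).2.trans (wish_mono hphys hb hN (h1 q hq).1 t.le_succ)⟩⟩
    rcases hb.step_or_idle hp' t with ⟨_, _, _, _, hs⟩ | ⟨h, -⟩
    · rcases hs.view_cases with ⟨h, -⟩ | ⟨-, h, -⟩
      · exact hsame h
      · rw [FlowSystem.cluster_eq_of_mem hp] at h
        refine ⟨_, h.honest_isWeakQuorum hN, fun q hq => ?_⟩
        obtain ⟨hq1, hq2⟩ := Finset.mem_inter.1 hq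
        have hq3 : q ∈ F.honestMembers i := Finset.mem_inter.2 ⟨h.1 hq1, hq2⟩
        obtain ⟨s, hs, h5⟩ := wish_of_mem_wishers hphys hb hq2 hq1
        exact ⟨hq3, h5.trans (wish_mono hphys hb hN hq3 (show s + 1 ≤ t + 1 by omega))⟩
    · exact hsame (by rw [h])

/-! ### The pacemaker after GST -/

section Timed

variable {gst Δ Φ : ℕ} (hT : ρ.Timely F gst Δ Φ)

include hT

omit hphys hN in
theorem mem_wishers {p q : Fin n} (hp : p ∈ F.honestMembers i) (hq : q ∈ F.honestMembers i)
    {t t' v : ℕ} (hgst : gst ≤ t) (hv : 0 < v) (hw : v ≤ (ρ.state t q).wish) (htt : t + Δ ≤ t') :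
    q ∈ F.wishers p (ρ.received t' p) v := by
  obtain ⟨s, hs, h⟩ := exists_sent_wish hb hq t (hv.trans_le hw)
  simp only [FlowSystem.wishers, Finset.mem_filter]
  rw [FlowSystem.cluster_eq_of_mem hp]
  exact ⟨(Finset.mem_inter.1 hq).1, _, hw, hT.received s t' q (FlowSystem.honest_of_mem hq) p
    (FlowSystem.honest_of_mem hp) _ (h p (Finset.mem_inter.1 hp).1) (by omega) (by omega)⟩

/-- Wishes arrive within `Δ`, and each member then acts within `Φ`: this is one round. -/
theorem wish_spreads {Q : Finset (Fin n)} (hQ : F.IsWeakQuorum i Q) {t v : ℕ} (hgst : gst ≤ t)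
    (hw : ∀ q ∈ Q, q ∈ F.honestMembers i ∧ v ≤ (ρ.state t q).wish) {p : Fin n}
    (hp : p ∈ F.honestMembers i) : v ≤ (ρ.state (t + Δ + Φ) p).wish := by
  rcases Nat.eq_zero_or_pos v with rfl | hv
  · exact Nat.zero_le _
  have hp' := FlowSystem.honest_of_mem hp
  obtain ⟨t', h1, h2, h3⟩ := hT.active p hp' (t + Δ) (by omega)
  obtain ⟨s₁, vote, k, B, hs⟩ := hb.takesStep hp' h3
  refine le_trans (hs.le_wish hphys hb hN hp (Or.inr (Or.inr ?_)))
    (wish_mono hphys hb hN hp (show t' + 1 ≤ t + Δ + Φ by omega))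
  exact hQ.mono (fun q hq => mem_wishers hb hT hp (hw q hq).1 hgst hv (hw q hq).2 h1)
    (FlowSystem.cluster_eq_of_mem hp ▸ FlowSystem.wishers_subset)

/-- Honest members form a quorum by themselves, so their wishes suffice without Byzantine help. -/
theorem view_follows_wish {t v : ℕ} (hgst : gst ≤ t)
    (hw : ∀ q ∈ F.honestMembers i, v ≤ (ρ.state t q).wish) {p : Fin n}
    (hp : p ∈ F.honestMembers i) : v ≤ (ρ.state (t + Δ + Φ) p).view := by
  rcases Nat.eq_zero_or_pos v with rfl | hv
  · exact Nat.zero_le _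
  have hp' := FlowSystem.honest_of_mem hp
  obtain ⟨t', h1, h2, h3⟩ := hT.active p hp' (t + Δ) (by omega)
  obtain ⟨s₁, vote, k, B, hs⟩ := hb.takesStep hp' h3
  refine le_trans (hs.le_view_of_isQuorum hphys hb hN hp ?_)
    (view_mono hb hp' (show t' + 1 ≤ t + Δ + Φ by omega))
  exact hN.isQuorum.mono (fun q hq => mem_wishers hb hT hp hq hgst hv (hw q hq) h1)
    (FlowSystem.cluster_eq_of_mem hp ▸ FlowSystem.wishers_subset)

/-- All honest members follow the first one into a view within two rounds. -/
theorem view_spreads {t v : ℕ} (hgst : gst ≤ t) {q : Fin n} (hq : q ∈ F.honestMembers i)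
    (hv : v ≤ (ρ.state t q).view) {p : Fin n} (hp : p ∈ F.honestMembers i) :
    v ≤ (ρ.state (t + 2 * (Δ + Φ)) p).view := by
  rcases Nat.eq_zero_or_pos v with rfl | hpos
  · exact Nat.zero_le _
  obtain ⟨Q, hQ, h⟩ := exists_weakQuorum_wish hphys hb hN hq t (by omega)
  have h1 : ∀ r ∈ F.honestMembers i, v ≤ (ρ.state (t + Δ + Φ) r).wish := fun r hr =>
    wish_spreads hphys hb hN hT hQ hgst (fun r hr => ⟨(h r hr).1, hv.trans (h r hr).2⟩) hr
  have h2 := view_follows_wish hphys hb hN hT (show gst ≤ t + Δ + Φ by omega) h1 hp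
  rwa [show t + 2 * (Δ + Φ) = t + Δ + Φ + Δ + Φ by ring]

/-- Were the wish to stay at most `v`, the view would be stuck at `v`, squeezed between its lower
bound and the wish. Its entry time would then be fixed while the local clock grows, so the node
would time out and wish for `v + 1`. -/
theorem eventually_wish {v : ℕ} {p : Fin n} (hp : p ∈ F.honestMembers i)
    (hv : ∀ᶠ t in atTop, v ≤ (ρ.state t p).view) :
    ∀ᶠ t in atTop, v + 1 ≤ (ρ.state t p).wish := by
  have hp' := FlowSystem.honest_of_mem hp
  by_contra hno
  have hw : ∀ t, (ρ.state t p).wish ≤ v := by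
    by_contra! h
    obtain ⟨t, h⟩ := h
    exact hno (eventually_atTop.2 ⟨t, fun t' ht' => h.trans_le (wish_mono hphys hb hN hp ht')⟩)
  obtain ⟨t₀, ht₀⟩ := eventually_atTop.1 hv
  have hview : ∀ t ≥ t₀, (ρ.state t p).view = v := fun t ht =>
    le_antisymm ((view_le_wish hphys hb hN hp t).trans (hw t)) (ht₀ t ht)
  have hent : ∀ t ≥ t₀, (ρ.state t p).entered = (ρ.state t₀ p).entered := by
    intro t ht
    induction t, ht using Nat.le_induction with
    | base => rfl
    | succ t ht ih =>
      rcases hb.step_or_idle hp' t with ⟨_, _, _, _, hs⟩ | ⟨h, -⟩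
      · have h1 := hview t ht
        have h2 := hview (t + 1) (by omega)
        rcases hs.view_cases with ⟨-, -, -, h⟩ | ⟨h, -⟩
        · exact h.trans ih
        · omega
      · rw [h]
        exact ih
  have hclock : ∀ c, ∃ t ≥ max t₀ gst, c ≤ (ρ.state t p).clock := by
    intro c
    induction c with
    | zero => exact ⟨_, le_rfl, Nat.zero_le _⟩
    | succ c ih =>
      obtain ⟨t, ht, h⟩ := ih
      obtain ⟨t', h1, h2, h3⟩ := hT.active p hp' t (by omega)
      obtain ⟨s₁, vote, k, B, hs⟩ := hb.takesStep hp' h3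
      refine ⟨t' + 1, by omega, ?_⟩
      have h4 := clock_mono hb hp' h1
      simp only at h4
      rw [hs.clock]
      omega
  obtain ⟨t, ht, h⟩ := hclock (F.timeout v + (ρ.state t₀ p).entered)
  obtain ⟨t', h1, h2, h3⟩ := hT.active p hp' t (by omega)
  obtain ⟨s₁, vote, k, B, hs⟩ := hb.takesStep hp' h3
  have h4 := clock_mono hb hp' h1
  have h5 := hent t' (by omega)
  have h6 := hview t' (by omega)
  simp only at h4
  have h7 := hs.le_wish hphys hb hN hp
    (Or.inr (Or.inl ⟨rfl, Or.inl (by rw [h5, h6]; omega)⟩))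
  have h8 := hw (t' + 1)
  omega

theorem eventually_view (v : ℕ) :
    ∀ᶠ t in atTop, ∀ p ∈ F.honestMembers i, v ≤ (ρ.state t p).view := by
  induction v with
  | zero => exact Eventually.of_forall fun _ _ _ => Nat.zero_le _
  | succ v ih =>
    have h : ∀ᶠ t in atTop, ∀ p ∈ F.honestMembers i, v + 1 ≤ (ρ.state t p).wish :=
      (Filter.eventually_all_finset _).2 fun p hp =>
        eventually_wish hphys hb hN hT hp (ih.mono fun t h => h p hp)
    obtain ⟨t, ht, hgst⟩ := (h.and (eventually_ge_atTop gst)).exists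
    refine eventually_atTop.2 ⟨t + Δ + Φ, fun t' ht' p hp => ?_⟩
    exact (view_follows_wish hphys hb hN hT hgst ht hp).trans
      (view_mono hb (FlowSystem.honest_of_mem hp) ht')

end Timed

omit hphys hN in
-- A local clock advances at most once per tick, so local time spent in a view never exceeds real
-- time since `t₀`. Thus no member times out early, however fast it runs.
theorem clock_sub_entered_le {t₀ v : ℕ} {p : Fin n} (hp : p ∈ F.honest)
    (hfirst : ∀ t < t₀, (ρ.state t p).view < v) (hpos : 0 < v) (t : ℕ)
    (hv : v ≤ (ρ.state t p).view) :
    t₀ ≤ t ∧ (ρ.state t p).clock + t₀ ≤ (ρ.state t p).entered + t := by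
  have hge : ∀ t, v ≤ (ρ.state t p).view → t₀ ≤ t := fun t h => by
    by_contra hlt
    have := hfirst t (by omega)
    omega
  refine ⟨hge t hv, ?_⟩
  induction t with
  | zero =>
    rw [(hb p hp).1] at hv
    simp only [NodeState.init] at hv
    omega
  | succ t ih =>
    have h0 := hge (t + 1) hv
    rcases hb.step_or_idle hp t with ⟨_, _, _, _, hs⟩ | ⟨h, -⟩
    · rcases hs.view_cases with ⟨h, -, -, h'⟩ | ⟨-, -, -, -, h⟩
      · have := ih (h ▸ hv)
        rw [hs.clock, h']
        omega
      · rw [hs.clock, h]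
        omega
    · rw [h] at hv ⊢
      have := ih hv
      omega

/-- If no honest member decides in view `v`, then none of them wishes to leave it before the first
one to enter it has timed out. -/
theorem wish_le_of_not_decides {t₀ v : ℕ} (hpos : 0 < v)
    (hfirst : ∀ t < t₀, ∀ p ∈ F.honestMembers i, (ρ.state t p).view < v)
    (hno : ∀ t, ∀ p ∈ F.honestMembers i, ∀ qc, ρ.Decides F t p qc → qc.view ≠ v)
    {t : ℕ} (ht : t < t₀ + F.timeout v) {p : Fin n} (hp : p ∈ F.honestMembers i) :
    (ρ.state t p).wish ≤ v := by
  induction t using Nat.strong_induction_on generalizing p with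
  | _ t ih =>
    have hp' := FlowSystem.honest_of_mem hp
    cases t with
    | zero =>
      rw [(hb p hp').1]
      exact Nat.zero_le _
    | succ t =>
      have hview : (ρ.state t p).view ≤ v :=
        (view_le_wish hphys hb hN hp t).trans (ih t (by omega) (by omega) hp)
      rcases hb.step_or_idle hp' t with ⟨s₁, _, _, _, hs⟩ | ⟨h, -⟩
      · rcases hs.wish_cases hphys hb hN hp with h | ⟨h, h'⟩ | h
        · rw [h]
          exact ih t (by omega) (by omega) hp
        · rcases hview.lt_or_eq with h1 | h1
          · omega
          exfalso
          rcases h' with h' | h'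
          · have := clock_sub_entered_le hb hp' (fun t ht => hfirst t ht p hp) hpos t h1.ge
            rw [h1] at h'
            omega
          · rcases hs.cases_decides with ⟨qc, h2⟩ | ⟨-, -, h2⟩
            · exact hno t p hp qc h2 (h2.view_eq.trans h1)
            · obtain ⟨s, -, qc, h3, h4⟩ :=
                exists_decides_of_stage hb hp' t (by omega) (h2 h')
              exact hno s p hp qc h3 (h4.trans h1)
        -- Joining a weak quorum means joining some honest member, whose earlier wish is at most `v`
        -- by induction.
        · obtain ⟨r, hr, hr'⟩ := h.exists_honest hN
          obtain ⟨s, hs, h1⟩ := wish_of_mem_wishers hphys hb (FlowSystem.honest_of_mem hr') hr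
          exact h1.trans (ih (s + 1) (by omega) (by omega) hr')
      · rw [h]
        exact ih t (by omega) (by omega) hp

end Pacemaker

end Run

/-! ## Views with an honest leader -/

theorem Phase.index_injective : Function.Injective Phase.index := by
  intro a b h
  cases a <;> cases b <;> simp_all [Phase.index]

namespace FlowSystem

variable {n : ℕ} {F : FlowSystem n} {p : Fin n} {R : Set (Fin n × Msg n)}
  {U : Set SignedTransaction}

theorem exists_isLeaderChoice (s : NodeState n) (b : Block) :
    ∃ b', F.IsLeaderChoice p R U s b b' := by
  by_cases h : F.ShouldClose s b
  · exact ⟨_, Or.inl ⟨h, rfl⟩⟩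
  · by_cases h' : ∃ l, F.Acceptable p R U b (Command.append l)
    · obtain ⟨l, hl⟩ := h'
      exact ⟨_, Or.inr (Or.inl ⟨h, l, hl, rfl⟩)⟩
    · exact ⟨_, Or.inr (Or.inr ⟨h, h', rfl⟩)⟩

theorem IsLeaderChoice.suffix {s : NodeState n} {b b' : Block}
    (h : F.IsLeaderChoice p R U s b b') : b <:+ b' := by
  rcases h with ⟨-, rfl⟩ | ⟨-, l, -, rfl⟩ | ⟨-, -, rfl⟩
  · exact List.suffix_cons _ _
  · exact List.suffix_cons _ _
  · exact List.suffix_refl _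

/-- Admissible certificates have views below the current one, so the maximum exists whatever
Byzantine members report. -/
theorem exists_isHighQC {i : ℕ} (hN : F.NonByzantine i) (hp : F.cluster p = i) {s : NodeState n}
    (h : ∀ q ∈ F.honestMembers i, ∃ qc, F.NewViewFrom p R s q qc) :
    ∃ qc, F.IsHighQC p R s qc := by
  classical
  let S : Set ℕ := {w | ∃ q qc, F.NewViewFrom p R s q qc ∧ qc.view = w}
  have hbdd : BddAbove S := by
    refine ⟨s.view, ?_⟩
    rintro w ⟨q, qc, ⟨-, -, -, -, h⟩, rfl⟩
    exact h.le
  obtain ⟨r, hr, -⟩ := hN.isQuorum.exists_honest hN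
  obtain ⟨qc', hqc'⟩ := h r hr
  have hne : S.Nonempty := ⟨_, r, qc', hqc', rfl⟩
  obtain ⟨q, qc, h1, h2⟩ := Nat.sSup_mem hne hbdd
  refine ⟨qc, ?_, ⟨q, h1⟩, fun q' qc'' h3 => ?_⟩
  · rw [hp]
    have h4 : F.honestMembers i ⊆
        Finset.univ.filter fun q => ∃ qc', F.NewViewFrom p R s q qc' := fun q hq => by
      simpa using h q hq
    have h5 : (Finset.univ.filter fun q => ∃ qc', F.NewViewFrom p R s q qc') ⊆
        F.members i := fun q hq => by
      simp only [Finset.mem_filter, Finset.mem_univ, true_and] at hq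
      obtain ⟨_, hq, -⟩ := hq
      rwa [hp] at hq
    convert hN.isQuorum.mono h4 h5
  · rw [h2]
    exact le_csSup hbdd ⟨q', qc'', h3, rfl⟩

end FlowSystem

namespace Run

variable {n : ℕ} {ρ : Run n} {F : FlowSystem n} {i : ℕ}

/-! ### Reading past messages off the current state -/

section History

variable (hb : ρ.HonestBehavior F)

include hb

theorem exists_sent_newView {p : Fin n} (hp : p ∈ F.honestMembers i) (t : ℕ)
    (hv : 0 < (ρ.state t p).view) :
    ∃ s < t, ∃ qc, F.ValidQC i qc ∧ qc.phase = Phase.prepare ∧ qc.view < (ρ.state t p).view ∧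
      ∀ q, F.IsLeader i (ρ.state t p).view q →
        Msg.newView (ρ.state t p).view qc ∈ ρ.sent s p q := by
  have hp' := FlowSystem.honest_of_mem hp
  induction t with
  | zero =>
    rw [(hb p hp').1] at hv
    exact absurd hv (lt_irrefl 0)
  | succ t ih =>
    by_cases heq : (ρ.state (t + 1) p).view = (ρ.state t p).view
    · rw [heq] at hv ⊢
      obtain ⟨s, hs, h⟩ := ih hv
      exact ⟨s, hs.trans (Nat.lt_succ_self t), h⟩
    · rcases hb.step_or_idle hp' t with ⟨_, _, _, _, hs⟩ | ⟨h, -⟩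
      · rcases hs.view_cases with ⟨h, -⟩ | ⟨-, -, h, -⟩
        · exact absurd h heq
        obtain ⟨h1, h2, h3⟩ := prepareQC_inv hb hp (t + 1)
        refine ⟨t, Nat.lt_succ_self t, _, h1, h2, by omega, fun q hq => ?_⟩
        rw [hs.out]
        exact Or.inr (Or.inr ⟨heq, by rwa [FlowSystem.cluster_eq_of_mem hp], rfl⟩)
      · exact absurd (by rw [h]) heq

theorem exists_propose {p : Fin n} (hp : p ∈ F.honest) (t : ℕ)
    (hv : 0 < (ρ.state t p).view) (hst : 0 < (ρ.state t p).leadStage) :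
    ∃ s < t, (ρ.state s p).view = (ρ.state t p).view ∧ ∃ s₁ vote k B,
      ρ.TakesStep F s p s₁ vote k B ∧ ∃ b qc,
      F.CanPropose p (ρ.received s p) (ρ.userTxs s p) s₁ b qc ∧
      B = {Msg.proposal (ρ.state t p).view b qc} := by
  induction t with
  | zero =>
    rw [(hb p hp).1] at hv
    exact absurd hv (lt_irrefl 0)
  | succ t ih =>
    have hold : (ρ.state (t + 1) p).view = (ρ.state t p).view → 0 < (ρ.state t p).leadStage →
        ∃ s < t + 1, (ρ.state s p).view = (ρ.state (t + 1) p).view ∧ ∃ s₁ vote k B,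
        ρ.TakesStep F s p s₁ vote k B ∧ ∃ b qc,
        F.CanPropose p (ρ.received s p) (ρ.userTxs s p) s₁ b qc ∧
        B = {Msg.proposal (ρ.state (t + 1) p).view b qc} := by
      intro h h'
      rw [h] at hv ⊢
      obtain ⟨s, hs, h⟩ := ih hv h'
      exact ⟨s, hs.trans (Nat.lt_succ_self t), h⟩
    rcases hb.step_or_idle hp t with ⟨s₁, vote, k, B, hs⟩ | ⟨h, -⟩
    · rcases hs.view_cases with ⟨h1, -, h2, -⟩ | ⟨-, -, -, h, -⟩
      · rcases hs.leader.cases with ⟨b, qc, h, -, h'⟩ | ⟨qc, h, -⟩ | ⟨h, -⟩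
        · refine ⟨t, Nat.lt_succ_self t, h1.symm, s₁, vote, k, B, hs, b, qc, h, ?_⟩
          rw [h', h1, hs.mid_view]
        · refine hold h1 ?_
          have := h.2.1
          rw [hs.mid_leadStage] at this
          omega
        · refine hold h1 ?_
          rwa [h2, h, hs.mid_leadStage] at hst
      · omega
    · exact hold (by rw [h]) (by rwa [h] at hst)

/-- After proposing, the leader stage rises by one certificate at a time, so no phase can have been
skipped. -/
theorem exists_sent_cert {p : Fin n} (hp : p ∈ F.honestMembers i) (t : ℕ)
    (hv : 0 < (ρ.state t p).view) {ph : Phase} (hst : ph.index + 2 ≤ (ρ.state t p).leadStage) :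
    ∃ s < t, ∃ qc : QC n, qc.phase = ph ∧ qc.view = (ρ.state t p).view ∧
      F.IsQuorum i qc.signers ∧ ∀ q ∈ F.members i, Msg.cert qc ∈ ρ.sent s p q := by
  have hp' := FlowSystem.honest_of_mem hp
  induction t with
  | zero =>
    rw [(hb p hp').1] at hv
    exact absurd hv (lt_irrefl 0)
  | succ t ih =>
    have hold : (ρ.state (t + 1) p).view = (ρ.state t p).view →
        ph.index + 2 ≤ (ρ.state t p).leadStage →
        ∃ s < t + 1, ∃ qc : QC n, qc.phase = ph ∧ qc.view = (ρ.state (t + 1) p).view ∧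
        F.IsQuorum i qc.signers ∧ ∀ q ∈ F.members i, Msg.cert qc ∈ ρ.sent s p q := by
      intro h h'
      rw [h] at hv ⊢
      obtain ⟨s, hs, h⟩ := ih hv h'
      exact ⟨s, hs.trans (Nat.lt_succ_self t), h⟩
    rcases hb.step_or_idle hp' t with ⟨s₁, vote, k, B, hs⟩ | ⟨h, -⟩
    · rcases hs.view_cases with ⟨h1, -, h2, -⟩ | ⟨-, -, -, h, -⟩
      · rcases hs.leader.cases with ⟨b, qc, -, h, -⟩ | ⟨qc, h, h3, h4⟩ | ⟨h, -⟩
        · omega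
        · have h5 := h.2.1
          rw [hs.mid_leadStage] at h5 h3
          by_cases h6 : qc.phase = ph
          · refine ⟨t, Nat.lt_succ_self t, qc, h6, ?_, ?_, fun q hq => ?_⟩
            · rw [h.2.2.1, h1, hs.mid_view]
            · exact FlowSystem.cluster_eq_of_mem hp ▸ h.2.2.2.1
            · refine hs.mem_sent_of_mem_broadcast (h4 ▸ rfl) ?_
              rwa [FlowSystem.cluster_eq_of_mem hp]
          · refine hold h1 ?_
            have h7 : qc.phase.index ≠ ph.index := fun h => h6 (Phase.index_injective h)
            omega
        · refine hold h1 ?_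
          rwa [h2, h, hs.mid_leadStage] at hst
      · omega
    · exact hold (by rw [h]) (by rwa [h] at hst)

/-- The exact stage is needed: a replica that sees a late certificate first may jump over earlier
votes, so a mere lower bound on the stage would not imply this vote. -/
theorem exists_sent_vote {p : Fin n} (hp : p ∈ F.honestMembers i) (t : ℕ)
    (hv : 0 < (ρ.state t p).view) {ph : Phase} (hst : (ρ.state t p).stage = ph.index + 1) :
    ∃ s < t, ∃ b, ∀ q, F.IsLeader i (ρ.state t p).view q →
      Msg.vote ph (ρ.state t p).view b ∈ ρ.sent s p q := by
  have hp' := FlowSystem.honest_of_mem hp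
  induction t with
  | zero =>
    rw [(hb p hp').1] at hv
    exact absurd hv (lt_irrefl 0)
  | succ t ih =>
    have hold : (ρ.state (t + 1) p).view = (ρ.state t p).view →
        (ρ.state t p).stage = ph.index + 1 →
        ∃ s < t + 1, ∃ b, ∀ q, F.IsLeader i (ρ.state (t + 1) p).view q →
        Msg.vote ph (ρ.state (t + 1) p).view b ∈ ρ.sent s p q := by
      intro h h'
      rw [h] at hv ⊢
      obtain ⟨s, hs, h⟩ := ih hv h'
      exact ⟨s, hs.trans (Nat.lt_succ_self t), h⟩
    rcases hb.step_or_idle hp' t with ⟨s₁, vote, k, B, hs⟩ | ⟨h, -⟩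
    · rcases hs.view_cases with ⟨h1, h2, -⟩ | ⟨-, -, h, -⟩
      · rcases hs.replica.stage_cases with h | ⟨-, h⟩ | ⟨ph', b, rfl⟩
        · exact hold h1 (h.symm.trans (h2.symm.trans hst))
        · rw [h2, h] at hst
          cases ph <;> simp [Phase.index] at hst
        · have h3 := hs.replica.stage_of_vote.2
          obtain rfl : ph' = ph := Phase.index_injective (by omega)
          refine ⟨t, Nat.lt_succ_self t, b, fun q hq => ?_⟩
          rw [h1] at hq ⊢
          rw [hs.out]
          exact Or.inr (Or.inl ⟨by rwa [FlowSystem.cluster_eq_of_mem hp], ph', b, rfl, rfl⟩)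
      · omega
    · exact hold (by rw [h]) (by rwa [h] at hst)

theorem exists_sent_tx {p : Fin n} (hp : p ∈ F.honest) (t : ℕ) {x : SignedTransaction}
    (hx : x ∈ (ρ.state t p).known) :
    ∃ s < t, ∀ q ∈ F.members (F.cluster p), Msg.tx x ∈ ρ.sent s p q := by
  induction t with
  | zero =>
    rw [(hb p hp).1] at hx
    exact hx.elim
  | succ t ih =>
    by_cases hx' : x ∈ (ρ.state t p).known
    · obtain ⟨s, hs, h⟩ := ih hx'
      exact ⟨s, hs.trans (Nat.lt_succ_self t), h⟩
    · rcases hb.step_or_idle hp t with ⟨s₁, vote, k, B, hs⟩ | ⟨h, -⟩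
      · refine ⟨t, Nat.lt_succ_self t, fun q hq => ?_⟩
        rw [hs.out]
        exact Or.inl ⟨hq, Or.inl ⟨x, ⟨hx, hx'⟩, rfl⟩⟩
      · rw [h] at hx
        exact absurd hx hx'

/-- What an honest member knows when it takes a step is soon known to every honest member. -/
theorem knownTxs_spreads {gst Δ Φ : ℕ} (hT : ρ.Timely F gst Δ Φ) {p q : Fin n}
    (hp : p ∈ F.honestMembers i) (hq : q ∈ F.honestMembers i) {t t' : ℕ} {s₁ : NodeState n}
    {vote : Option (Phase × Block)} {k : ℕ} {B : Set (Msg n)}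
    (hs : ρ.TakesStep F t p s₁ vote k B) (h1 : t + Δ ≤ t') (h2 : gst + Δ ≤ t') :
    F.knownTxs p (ρ.received t p) (ρ.userTxs t p) ⊆
      F.knownTxs q (ρ.received t' q) (ρ.userTxs t' q) := by
  intro x hx
  have hp' := FlowSystem.honest_of_mem hp
  rw [← hs.known] at hx
  obtain ⟨s, h3, h4⟩ := exists_sent_tx hb hp' (t + 1) hx
  rw [hs.known] at hx
  rw [FlowSystem.cluster_eq_of_mem hp] at h4
  refine ⟨Or.inr ⟨p, ?_, hT.received s t' p hp' q (FlowSystem.honest_of_mem hq) _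
    (h4 q (Finset.mem_inter.1 hq).1) (by omega) h2⟩, hx.2.1, ?_⟩
  · rw [FlowSystem.cluster_eq_of_mem hq]
    exact (Finset.mem_inter.1 hp).1
  · rw [hx.2.2, FlowSystem.cluster_eq_of_mem hp, FlowSystem.cluster_eq_of_mem hq]

end History

/-! ### Eight rounds under an honest leader -/

section GoodView

variable (hphys : ρ.Physical) (hb : ρ.HonestBehavior F) (hu : ρ.Unforgeable F)
  (hN : F.NonByzantine i) {v : ℕ} (hv : 0 < v) {L : Fin n} (hL : L ∈ F.honestMembers i)
  (hlead : F.IsLeader i v L)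

include hphys hb hv hL hlead

omit hv in
-- An honest leader certifies a phase from leader stage `index + 1` and moves on in the same step.
-- Leader stages do not drop while the view lasts.
theorem leadStage_of_received_cert {p : Fin n} {t : ℕ} {qc : QC n} {ldr : Fin n}
    (hldr : F.IsLeader i v ldr) (hm : (ldr, Msg.cert qc) ∈ ρ.received t p)
    (hqv : qc.view = v) (hLv : (ρ.state t L).view = v) :
    qc.phase.index + 2 ≤ (ρ.state t L).leadStage := by
  obtain rfl := hldr.unique hlead
  have hL' := FlowSystem.honest_of_mem hL
  obtain ⟨s, hs, hm⟩ := hphys.exists_sent hm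
  obtain ⟨s₁, vote, k, B, hst⟩ := hb.takesStep_of_mem_sent hL' hm
  obtain ⟨h1, -, h2, h3, -⟩ := hst.of_sent_cert hm
  rw [hst.mid_leadStage] at h2
  rw [hst.mid_view] at h3
  have h4 := view_mono hb hL' (show s + 1 ≤ t from hs)
  simp only at h4
  rcases hst.view_cases with ⟨h5, -, h6, -⟩ | ⟨h5, -⟩
  · have := (stage_mono hb hL' (show s + 1 ≤ t from hs) (by omega)).2
    omega
  · omega

/-- In a view with an honest leader, replicas are never ahead of the leader. -/
theorem stage_le_leadStage {p : Fin n} (hp : p ∈ F.honestMembers i) {t : ℕ}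
    (hpv : (ρ.state t p).view = v) (hLv : (ρ.state t L).view = v) :
    (ρ.state t p).stage ≤ (ρ.state t L).leadStage := by
  have hp' := FlowSystem.honest_of_mem hp
  have hL' := FlowSystem.honest_of_mem hL
  have hrec : ∀ {s q m}, s < t → (q, m) ∈ ρ.received s p → (q, m) ∈ ρ.received t p := by
    rintro s q m hs ⟨s', a, h1, h2, h3⟩
    exact ⟨s', a, h1, h2, h3.trans hs.le⟩
  have h4 := stage_le_four hb hp' t
  obtain h | h | h | h | h : (ρ.state t p).stage = 0 ∨
      (ρ.state t p).stage = Phase.prepare.index + 1 ∨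
      (ρ.state t p).stage = Phase.preCommit.index + 1 ∨
      (ρ.state t p).stage = Phase.commit.index + 1 ∨ (ρ.state t p).stage = 4 := by
    simp only [Phase.index]
    omega
  · omega
  · obtain ⟨s, hs, b, hm⟩ := exists_sent_vote hb hp t (by omega) h
    rw [hpv] at hm
    obtain ⟨-, -, ldr, qc, h1, h2, -⟩ := sent_vote_prepare hb hp (hm L hlead)
    obtain rfl := h1.unique hlead
    obtain ⟨s', hs', h3⟩ := hphys.exists_sent h2
    obtain ⟨s₁, vote, k, B, hst⟩ := hb.takesStep_of_mem_sent hL' h3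
    obtain ⟨h5, h6, -⟩ := hst.of_sent_proposal h3
    have h7 := view_mono hb hL' (show s' + 1 ≤ t by omega)
    simp only at h7
    rcases hst.view_cases with ⟨h8, -, h9, -⟩ | ⟨h8, -⟩
    · have := (stage_mono hb hL' (show s' + 1 ≤ t by omega) (by omega)).2
      simp only [Phase.index] at h
      omega
    · omega
  · obtain ⟨s, hs, b, hm⟩ := exists_sent_vote hb hp t (by omega) h
    rw [hpv] at hm
    obtain ⟨qc, ldr, h1, h2, -, h3, h5, -⟩ := sent_vote_preCommit hb hp (hm L hlead)
    have := leadStage_of_received_cert hphys hb hL hlead h1 (hrec hs h2) h5 hLv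
    rw [h3] at this
    simp only [Phase.index] at h this
    omega
  · obtain ⟨s, hs, b, hm⟩ := exists_sent_vote hb hp t (by omega) h
    rw [hpv] at hm
    obtain ⟨qc, ldr, h1, h2, -, h3, h5, -⟩ := sent_vote_commit hb hp (hm L hlead)
    have := leadStage_of_received_cert hphys hb hL hlead h1 (hrec hs h2) h5 hLv
    rw [h3] at this
    simp only [Phase.index] at h this
    omega
  · obtain ⟨s, hs, qc, h1, h2⟩ := exists_decides_of_stage hb hp' t (by omega) h
    have h8 := h1.view_eq
    obtain ⟨-, ldr, h3, h5, -, h6, h7⟩ := h1.canAccept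
    simp only at h3
    rw [FlowSystem.cluster_eq_of_mem hp, ← h8, h2, hpv] at h3
    have := leadStage_of_received_cert hphys hb hL hlead h3 (hrec hs h5) (h2.trans hpv) hLv
    rw [h6] at this
    simp only [Phase.index] at this
    omega

include hu hN

omit hv hL in
/-- In a view with an honest leader, all honest votes are for blocks that it proposed. -/
theorem exists_sent_proposal_of_vote {p q : Fin n} (hp : p ∈ F.honestMembers i) {t : ℕ}
    {ph : Phase} {b : Block} (hm : Msg.vote ph v b ∈ ρ.sent t p q) :
    ∃ s q' qc, Msg.proposal v b qc ∈ ρ.sent s L q' := by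
  have hprep : ∀ {p q : Fin n} {t : ℕ}, p ∈ F.honestMembers i →
      Msg.vote Phase.prepare v b ∈ ρ.sent t p q →
      ∃ s q' qc, Msg.proposal v b qc ∈ ρ.sent s L q' := by
    intro p q t hp hm
    obtain ⟨-, -, ldr, qc, h1, h2, -⟩ := sent_vote_prepare hb hp hm
    obtain rfl := h1.unique hlead
    obtain ⟨s', hs', h3⟩ := hphys.exists_sent h2
    exact ⟨s', p, qc, h3⟩
  cases ph with
  | prepare => exact hprep hp hm
  | preCommit =>
    obtain ⟨r, hr, t', q', hm'⟩ := (certified_prepare_of_vote hphys hb hu hp hm).exists_vote hN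
    exact hprep hr hm'
  | commit =>
    obtain ⟨r, hr, t', q', hm'⟩ := ((certified_preCommit_of_vote hphys hb hu hp
      hm).prepare hphys hb hu hN).exists_vote hN
    exact hprep hr hm'

variable {gst Δ Φ : ℕ} (hT : ρ.Timely F gst Δ Φ)

include hT

omit hphys hv hL hlead hu hN in
-- In a round, everything sent before tick `a` has arrived after `Δ` ticks, and the node takes a
-- step in the next `Φ`. Monotone stages transfer what holds at that step to the ends of the round.
theorem exists_takesStep_in_round {p : Fin n} (hp : p ∈ F.honestMembers i) {a : ℕ}
    (ha : gst ≤ a) (hview : ∀ t, a ≤ t → t ≤ a + (Δ + Φ) → (ρ.state t p).view = v) :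
    ∃ t s₁ vote k B, a + Δ ≤ t ∧ ρ.TakesStep F t p s₁ vote k B ∧ (ρ.state t p).view = v ∧
      (ρ.state a p).stage ≤ (ρ.state t p).stage ∧
      (ρ.state a p).leadStage ≤ (ρ.state t p).leadStage ∧
      s₁.stage ≤ (ρ.state (a + (Δ + Φ)) p).stage ∧
      k ≤ (ρ.state (a + (Δ + Φ)) p).leadStage ∧ t ≤ a + (Δ + Φ) := by
  have hp' := FlowSystem.honest_of_mem hp
  obtain ⟨t, h1, h2, h3⟩ := hT.active p hp' (a + Δ) (by omega)
  obtain ⟨s₁, vote, k, B, hs⟩ := hb.takesStep hp' h3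
  have h4 := hview t (by omega) (by omega)
  have h5 := hview (t + 1) (by omega) (by omega)
  have h6 := stage_mono hb hp' (show a ≤ t by omega) (by rw [h4, hview a le_rfl (by omega)])
  have h7 := stage_mono hb hp' (show t + 1 ≤ a + (Δ + Φ) by omega)
    (by rw [h5, hview _ (by omega) le_rfl])
  refine ⟨t, s₁, vote, k, B, h1, hs, h4, h6.1, h6.2, ?_, ?_, by omega⟩
  · rcases hs.view_cases with ⟨-, h8, -⟩ | ⟨h8, -⟩
    · exact h8 ▸ h7.1
    · omega
  · rcases hs.view_cases with ⟨-, -, h8, -⟩ | ⟨h8, -⟩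
    · exact h8 ▸ h7.2
    · omega

variable {a : ℕ} (ha : gst ≤ a) (hview : ∀ t, a ≤ t → t ≤ a + (Δ + Φ) →
  ∀ p ∈ F.honestMembers i, (ρ.state t p).view = v)

include ha hview

omit hphys hu in
-- By the step in this round all honest members, a quorum, have reported to the leader, and a leader
-- choice always exists.
theorem leader_proposes : 1 ≤ (ρ.state (a + (Δ + Φ)) L).leadStage := by
  obtain ⟨t, s₁, vote, k, B, h1, hs, h2, -, h4, -, h5, -⟩ :=
    exists_takesStep_in_round hb hT hL ha fun t h h' => hview t h h' L hL
  refine le_trans ?_ h5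
  by_contra hk
  have h6 := hs.leader.leadStage_le
  have hc := FlowSystem.cluster_eq_of_mem hL
  obtain ⟨qc, hqc⟩ := FlowSystem.exists_isHighQC (R := ρ.received t L) (s := s₁) hN hc
    fun q hq => by
      have h7 := hview a le_rfl (by omega) q hq
      obtain ⟨s, h8, qc, h9, h10, h11, h12⟩ := exists_sent_newView hb hq a (by omega)
      rw [h7] at h11 h12
      refine ⟨qc, ?_, ?_, ?_, h10, ?_⟩
      · rw [hc]
        exact (Finset.mem_inter.1 hq).1
      · rw [hs.mid_view, h2]
        exact hT.received s t q (FlowSystem.honest_of_mem hq) L (FlowSystem.honest_of_mem hL) _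
          (h12 L hlead) (by omega) (by omega)
      · rwa [hc]
      · rwa [hs.mid_view, h2]
  obtain ⟨b, hbl⟩ := FlowSystem.exists_isLeaderChoice (F := F) (p := L) (R := ρ.received t L)
    (U := ρ.userTxs t L) s₁ qc.block
  have h7 := hs.leader.leadStage_lt (Or.inl ⟨b, qc, ?_, by omega, hqc, hbl⟩)
  · omega
  · rwa [hc, hs.mid_view, h2]

/-- The leader broadcast its transactions no later than its proposal, so the replica knows them too.
The rule `safeNode` holds because the justification is at least as recent as the lock. -/
theorem replica_votes_prepare (hLst : 1 ≤ (ρ.state a L).leadStage) {p : Fin n}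
    (hp : p ∈ F.honestMembers i) : 1 ≤ (ρ.state (a + (Δ + Φ)) p).stage := by
  obtain ⟨t, s₁, vote, k, B, h1, hs, h2, h3, -, h5, -, -⟩ :=
    exists_takesStep_in_round hb hT hp ha fun t h h' => hview t h h' p hp
  refine le_trans ?_ h5
  by_contra hk
  have h6 := hs.replica.stage_le
  simp only at h6
  have hcL := FlowSystem.cluster_eq_of_mem hL
  have hcp := FlowSystem.cluster_eq_of_mem hp
  have hL' := FlowSystem.honest_of_mem hL
  have hp' := FlowSystem.honest_of_mem hp
  have hLv := hview a le_rfl (by omega) L hL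
  obtain ⟨s, hsa, hsv, s₂, vote', k', B', hs', b, qc, hprop, hB⟩ :=
    exists_propose hb hL' a (by omega) hLst
  rw [hLv] at hsv hB
  have hrec : (L, Msg.proposal v b qc) ∈ ρ.received t p := by
    refine hT.received s t L hL' p hp' _ (hs'.mem_sent_of_mem_broadcast (hB ▸ rfl) ?_)
      (by omega) (by omega)
    rw [hcL]
    exact (Finset.mem_inter.1 hp).1
  obtain ⟨-, -, hhigh, hchoice⟩ := hprop
  have hs₂ : s₂.view = v := hs'.mid_view.trans hsv
  obtain ⟨-, ⟨q, -, hrecq, hvalid, hphase, hqv⟩, -⟩ := id hhigh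
  rw [hs₂] at hqv
  rw [hcL] at hvalid
  have h7 := hs.replica.stage_lt (Or.inl ⟨b, ?_⟩)
  · simp only at h7
    omega
  have hst : (ρ.state t p).stage = 0 := by omega
  refine ⟨hst, L, qc, ?_, ?_, hcp ▸ hvalid, hphase, h2.symm ▸ hqv, ?_, ?_⟩
  · simpa only [hcp, h2] using hlead
  · simpa only [h2] using hrec
  · rcases hchoice with ⟨h8, rfl⟩ | ⟨-, l, h8, rfl⟩ | ⟨-, -, rfl⟩
    · exact Or.inr ⟨_, rfl, h8.1⟩
    · refine Or.inr ⟨_, rfl, h8.1, h8.2.1, h8.2.2.1, fun h hh => ?_⟩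
      obtain ⟨x, hx, hxh⟩ := h8.2.2.2 h hh
      exact ⟨x, knownTxs_spreads hb hT hL hp hs' (by omega) (by omega) hx, hxh⟩
    · exact Or.inl rfl
  · change (ρ.state t p).lockedQC.block <:+ b ∨ (ρ.state t p).lockedQC.view < qc.view
    rcases lockedQC_certified hphys hb hu hp t with h8 | h8
    · left
      rw [h8]
      exact List.nil_suffix
    · have h9 := (lockedQC_inv hb hp t).2
      have h10 := le_view_of_isHighQC hphys hb hN hL h8 (by omega) hhigh
      -- A newer justification unlocks. One of the same view certifies the locked block itself, by
      -- uniqueness, and the proposal extends it.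
      rcases h10.lt_or_eq with h10 | h10
      · exact Or.inr h10
      · left
        have h11 := h8.view_pos hb hN
        have h12 := ((signed_of_received hphys hb hu hrecq rfl).eq_genesis_or_certified
          hvalid).resolve_left fun h => by
            rw [h] at h10
            simp only [QC.genesis] at h10
            omega
        rw [hphase, ← h10] at h12
        rw [(h8.prepare hphys hb hu hN).unique hb hN h12]
        exact hchoice.suffix

omit hphys hu hN in
theorem replica_accepts {ph : Phase} (hLst : ph.index + 2 ≤ (ρ.state a L).leadStage) {p : Fin n}
    (hp : p ∈ F.honestMembers i) (hst : ph.index + 1 ≤ (ρ.state a p).stage) :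
    ph.index + 2 ≤ (ρ.state (a + (Δ + Φ)) p).stage := by
  obtain ⟨t, s₁, vote, k, B, h1, hs, h2, h3, -, h5, -, -⟩ :=
    exists_takesStep_in_round hb hT hp ha fun t h h' => hview t h h' p hp
  refine le_trans ?_ h5
  by_contra hk
  have h6 := hs.replica.stage_le
  simp only at h6
  have hcp := FlowSystem.cluster_eq_of_mem hp
  have hLv := hview a le_rfl (by omega) L hL
  obtain ⟨s, hsa, qc, hq1, hq2, hq3, hq4⟩ := exists_sent_cert hb hL a (by omega) hLst
  have h7 := hs.replica.stage_lt (Or.inr ⟨ph, qc, ?_⟩)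
  · simp only at h7
    omega
  refine ⟨by simp only; omega, L, ?_, ?_, ?_, hq1, ?_⟩
  · simpa only [hcp, h2] using hlead
  · exact hT.received s t L (FlowSystem.honest_of_mem hL) p (FlowSystem.honest_of_mem hp) _
      (hq4 p (Finset.mem_inter.1 hp).1) (by omega) (by omega)
  · rw [hcp]
    exact Or.inr hq3
  · simp only [hq2, h2, hLv]

/-- If the leader still waits in phase `ph`, no replica can be ahead of it, so all honest replicas
are exactly at stage `ph.index + 1` and have cast the votes of this phase. -/
theorem leader_certifies {ph : Phase} (hLst : ph.index + 1 ≤ (ρ.state a L).leadStage)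
    (hst : ∀ p ∈ F.honestMembers i, ph.index + 1 ≤ (ρ.state a p).stage) :
    ph.index + 2 ≤ (ρ.state (a + (Δ + Φ)) L).leadStage := by
  obtain ⟨t, s₁, vote, k, B, h1, hs, h2, -, h4, -, h5, h6⟩ :=
    exists_takesStep_in_round hb hT hL ha fun t h h' => hview t h h' L hL
  refine le_trans ?_ h5
  by_contra hk
  have h7 := hs.leader.leadStage_le
  rw [hs.mid_leadStage] at h7
  have hcL := FlowSystem.cluster_eq_of_mem hL
  have hL' := FlowSystem.honest_of_mem hL
  have hvote : ∀ p ∈ F.honestMembers i, ∃ s < a, ∃ b, Msg.vote ph v b ∈ ρ.sent s p L := by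
    intro p hp
    have hpv := hview a le_rfl (by omega) p hp
    have h8 := (stage_mono hb (FlowSystem.honest_of_mem hp) (show a ≤ t by omega)
      (by rw [hpv, hview t (by omega) h6 p hp])).1
    have h9 := stage_le_leadStage hphys hb hv hL hlead hp (hview t (by omega) h6 p hp) h2
    have h10 := hst p hp
    obtain ⟨s, hsa, b, hm⟩ := exists_sent_vote hb hp a (by omega) (ph := ph) (by omega)
    rw [hpv] at hm
    exact ⟨s, hsa, b, hm L hlead⟩
  obtain ⟨s₀, -, b, hm₀⟩ := hvote L hL
  obtain ⟨s', q', qc', hprop⟩ := exists_sent_proposal_of_vote hphys hb hu hN hlead hL hm₀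
  -- The honest members alone can sign. Their votes agree on the block because an honest leader
  -- proposes only one per view.
  have h8 := hs.leader.leadStage_lt (Or.inr ⟨⟨ph, v, b, F.honestMembers i⟩, ?_⟩)
  · rw [hs.mid_leadStage] at h8
    omega
  refine ⟨?_, ?_, ?_, ?_, fun p hp => ?_⟩
  · rwa [hcL, hs.mid_view, h2]
  · rw [hs.mid_leadStage]
    simp only
    omega
  · rw [hs.mid_view, h2]
  · rw [hcL]
    exact hN.isQuorum
  · obtain ⟨s, hsa, b', hm⟩ := hvote p hp
    obtain ⟨s'', q'', qc'', hprop'⟩ := exists_sent_proposal_of_vote hphys hb hu hN hlead hp hm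
    obtain rfl := proposal_unique hb hL' hprop hprop'
    exact hT.received s t p (FlowSystem.honest_of_mem hp) L hL' _ hm (by omega) (by omega)

omit ha hview in
/-- Once every honest member stays in a view with an honest leader for eight rounds, a block is
decided in it. -/
theorem exists_decides_in_view (ha : gst ≤ a) (hview : ∀ t, a ≤ t → t ≤ a + 8 * (Δ + Φ) →
    ∀ p ∈ F.honestMembers i, (ρ.state t p).view = v) :
    ∃ t, ∃ p ∈ F.honestMembers i, ∃ qc, ρ.Decides F t p qc ∧ qc.view = v := by
  have hround : ∀ j < 8, ∀ t, a + j * (Δ + Φ) ≤ t → t ≤ a + j * (Δ + Φ) + (Δ + Φ) →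
      ∀ p ∈ F.honestMembers i, (ρ.state t p).view = v := by
    intro j hj t h1 h2
    have : (j + 1) * (Δ + Φ) ≤ 8 * (Δ + Φ) := Nat.mul_le_mul_right _ (by omega)
    rw [add_mul, one_mul] at this
    exact hview t (by omega) (by omega)
  have hga : ∀ j, gst ≤ a + j * (Δ + Φ) := fun j => ha.trans (Nat.le_add_right _ _)
  have hnext : ∀ j, a + (j + 1) * (Δ + Φ) = a + j * (Δ + Φ) + (Δ + Φ) := fun j => by ring
  have hLmono : ∀ j < 8, (ρ.state (a + j * (Δ + Φ)) L).leadStage ≤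
      (ρ.state (a + (j + 1) * (Δ + Φ)) L).leadStage := by
    intro j hj
    rw [hnext]
    refine (stage_mono hb (FlowSystem.honest_of_mem hL) (Nat.le_add_right _ _) ?_).2
    rw [hround j hj _ (Nat.le_add_right _ _) le_rfl L hL,
      hround j hj _ le_rfl (Nat.le_add_right _ _) L hL]
  have hpmono : ∀ j < 8, ∀ p ∈ F.honestMembers i, (ρ.state (a + j * (Δ + Φ)) p).stage ≤
      (ρ.state (a + (j + 1) * (Δ + Φ)) p).stage := by
    intro j hj p hp
    rw [hnext]
    refine (stage_mono hb (FlowSystem.honest_of_mem hp) (Nat.le_add_right _ _) ?_).1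
    rw [hround j hj _ (Nat.le_add_right _ _) le_rfl p hp,
      hround j hj _ le_rfl (Nat.le_add_right _ _) p hp]
  have hlead' : ∀ j < 8, ∀ ph : Phase, ph.index + 1 ≤ (ρ.state (a + j * (Δ + Φ)) L).leadStage →
      (∀ p ∈ F.honestMembers i, ph.index + 1 ≤ (ρ.state (a + j * (Δ + Φ)) p).stage) →
      ph.index + 2 ≤ (ρ.state (a + (j + 1) * (Δ + Φ)) L).leadStage ∧
      ∀ p ∈ F.honestMembers i, ph.index + 1 ≤ (ρ.state (a + (j + 1) * (Δ + Φ)) p).stage := by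
    intro j hj ph h1 h2
    refine ⟨?_, fun p hp => (h2 p hp).trans (hpmono j hj p hp)⟩
    rw [hnext]
    exact leader_certifies hphys hb hu hN hv hL hlead hT (hga j) (hround j hj) h1 h2
  have hrep : ∀ j < 8, ∀ ph : Phase, (ph.index + 2 ≤ (ρ.state (a + j * (Δ + Φ)) L).leadStage ∧
      ∀ p ∈ F.honestMembers i, ph.index + 1 ≤ (ρ.state (a + j * (Δ + Φ)) p).stage) →
      ph.index + 2 ≤ (ρ.state (a + (j + 1) * (Δ + Φ)) L).leadStage ∧
      ∀ p ∈ F.honestMembers i, ph.index + 2 ≤ (ρ.state (a + (j + 1) * (Δ + Φ)) p).stage := by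
    intro j hj ph h
    refine ⟨h.1.trans (hLmono j hj), fun p hp => ?_⟩
    rw [hnext]
    exact replica_accepts hb hv hL hlead hT (hga j) (hround j hj) h.1 hp (h.2 p hp)
  -- One round for the proposal, one for the prepare votes, then for each of the three phases one to
  -- certify and one to accept.
  have h1 : 1 ≤ (ρ.state (a + 1 * (Δ + Φ)) L).leadStage := by
    have := leader_proposes hb hN hv hL hlead hT (hga 0) (hround 0 (by norm_num))
    rwa [← hnext] at this
  have h2 : ∀ p ∈ F.honestMembers i, 1 ≤ (ρ.state (a + 2 * (Δ + Φ)) p).stage := fun p hp => by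
    have := replica_votes_prepare hphys hb hu hN hv hL hlead hT (hga 1)
      (hround 1 (by norm_num)) h1 hp
    rwa [← hnext] at this
  have h4 := hrep 3 (by norm_num) _ (hlead' 2 (by norm_num) Phase.prepare
    (h1.trans (hLmono 1 (by norm_num))) h2)
  have h6 := hrep 5 (by norm_num) _ (hlead' 4 (by norm_num) Phase.preCommit h4.1 h4.2)
  have h8 := hrep 7 (by norm_num) _ (hlead' 6 (by norm_num) Phase.commit h6.1 h6.2)
  have hLv := hview (a + 8 * (Δ + Φ)) (Nat.le_add_right _ _) le_rfl L hL
  have hL' := FlowSystem.honest_of_mem hL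
  obtain ⟨s, -, qc, h9, h10⟩ := exists_decides_of_stage hb hL' (a + 8 * (Δ + Φ))
    (hLv ▸ hv) (le_antisymm (stage_le_four hb hL' _) (h8.2 L hL))
  exact ⟨s, L, hL, qc, h9, h10.trans hLv⟩

end GoodView

/-- In every sufficiently late view with an honest leader an honest member decides, and does so
late. -/
theorem eventually_exists_decides (hphys : ρ.Physical) (hb : ρ.HonestBehavior F)
    (hu : ρ.Unforgeable F) (hN : F.NonByzantine i) {gst Δ Φ : ℕ} (hT : ρ.Timely F gst Δ Φ)
    (htimeout : Tendsto F.timeout atTop atTop) (T : ℕ) :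
    ∀ᶠ v in atTop, ∀ L ∈ F.honestMembers i, F.IsLeader i v L →
      ∃ t > T, ∃ p ∈ F.honestMembers i, ∃ qc, ρ.Decides F t p qc ∧ qc.view = v := by
  classical
  -- A view above all honest views at tick `max T gst` is entered, and so decided, only after `T`
  -- and after GST.
  have hlate : ∀ᶠ v in atTop, ∀ p ∈ F.honestMembers i, (ρ.state (max T gst) p).view < v :=
    (Filter.eventually_all_finset _).2 fun p _ => eventually_gt_atTop _
  -- The ten rounds are two for gathering all honest members in the view and eight for deciding.
  filter_upwards [hlate, eventually_gt_atTop 0,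
    htimeout.eventually_gt_atTop (10 * (Δ + Φ))] with v hv hpos hto L hL hlead
  obtain ⟨t₀, ht₀, hmin⟩ : ∃ t₀, (∃ p ∈ F.honestMembers i, v ≤ (ρ.state t₀ p).view) ∧
      ∀ t < t₀, ∀ p ∈ F.honestMembers i, (ρ.state t p).view < v := by
    have hex : ∃ t, ∃ p ∈ F.honestMembers i, v ≤ (ρ.state t p).view := by
      obtain ⟨t, ht⟩ := (eventually_view hphys hb hN hT v).exists
      exact ⟨t, L, hL, ht L hL⟩
    refine ⟨Nat.find hex, Nat.find_spec hex, fun t ht p hp => ?_⟩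
    by_contra h
    exact Nat.find_min hex ht ⟨p, hp, not_lt.1 h⟩
  have hge : ∀ t, (∃ p ∈ F.honestMembers i, v ≤ (ρ.state t p).view) → max T gst < t := by
    rintro t ⟨p, hp, h⟩
    by_contra hle
    have h1 := view_mono hb (FlowSystem.honest_of_mem hp) (not_lt.1 hle)
    have h2 := hv p hp
    simp only at h1
    omega
  have hgst := hge t₀ ht₀
  obtain ⟨q, hq, hqv⟩ := ht₀
  by_contra! hno
  have hno' : ∀ t, ∀ p ∈ F.honestMembers i, ∀ qc, ρ.Decides F t p qc → qc.view ≠ v := by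
    intro t p hp qc h heq
    refine hno t ?_ p hp qc h heq
    have := hge t ⟨p, hp, (heq.symm.trans h.view_eq).le⟩
    omega
  -- Without a decision in `v` the wishes, and hence the views, stay at most `v` until the time-out.
  -- From two rounds after `t₀` on the views are also at least `v`.
  obtain ⟨t, p, hp, qc, h1, h2⟩ := exists_decides_in_view hphys hb hu hN hpos hL hlead hT
    (a := t₀ + 2 * (Δ + Φ)) (by omega) fun t h1 h2 p hp => by
      refine le_antisymm ((view_le_wish hphys hb hN hp t).trans
        (wish_le_of_not_decides hphys hb hN hpos hmin hno' (by omega) hp)) ?_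
      exact (view_spreads hphys hb hN hT (by omega) hq hqv hp).trans
        (view_mono hb (FlowSystem.honest_of_mem hp) h1)
  exact hno' t p hp qc h1 h2

end Run

/-! ## Progress -/

namespace Run

variable {n : ℕ} {ρ : Run n} {F : FlowSystem n} {i : ℕ}

/-- Genesis carries the prepare phase, so it cannot serve as a commit certificate. -/
theorem Decides.isQuorum {p : Fin n} (hp : p ∈ F.honestMembers i) {t : ℕ} {qc : QC n}
    (h : ρ.Decides F t p qc) : F.IsQuorum i qc.signers := by
  have h1 := h.canAccept.validQC
  rw [FlowSystem.cluster_eq_of_mem hp] at h1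
  refine h1.resolve_left fun h2 => ?_
  have h3 := h.canAccept.phase_eq
  rw [h2] at h3
  cases h3

theorem Decides.certified (hphys : ρ.Physical) (hb : ρ.HonestBehavior F) (hu : ρ.Unforgeable F)
    {p : Fin n} (hp : p ∈ F.honestMembers i) {t : ℕ} {qc : QC n} (h : ρ.Decides F t p qc) :
    ρ.Certified F i Phase.commit qc.view qc.block := by
  obtain ⟨-, ldr, -, h1, -⟩ := h.canAccept
  have h2 := (signed_of_received hphys hb hu h1 rfl).certified (h.isQuorum hp)
  rwa [h.canAccept.phase_eq] at h2

section Progress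

variable (hphys : ρ.Physical) (hb : ρ.HonestBehavior F) (hu : ρ.Unforgeable F)
  (hN : F.NonByzantine i) {gst Δ Φ : ℕ} (hT : ρ.Timely F gst Δ Φ)
  (hwork : ρ.KeepsSubmitting F)

include hb hN hT hwork

/-- Eventually all honest members know a transaction that does not occur on a given branch. -/
theorem exists_fresh_known (b : Block) : ∃ T, ∀ t ≥ T, ∀ p ∈ F.honestMembers i,
    ∃ x ∈ F.knownTxs p (ρ.received t p) (ρ.userTxs t p), F.txHash x ∉ loggedHashes b := by
  obtain ⟨h, ⟨t, q, hq, x, hx, hwf, hc, rfl⟩, hnew⟩ :=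
    (hwork i hN).exists_notMem_finset (loggedHashes b).toFinset
  obtain ⟨t', h1, -, h2⟩ := hT.active q (FlowSystem.honest_of_mem hq) (max t gst) (by omega)
  obtain ⟨s₁, vote, k, B, hs⟩ := hb.takesStep (FlowSystem.honest_of_mem hq) h2
  refine ⟨t' + Δ, fun t'' ht p hp => ⟨x, ?_, by simpa using hnew⟩⟩
  refine knownTxs_spreads hb hT hq hp hs ht (by omega) ⟨Or.inl ⟨t, by omega, hx⟩, hwf, ?_⟩
  rw [FlowSystem.cluster_eq_of_mem hq, hc]

include hphys hu

/-- After a block that is genesis or decided, honest members decide again, on a strictly longer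
branch that an honest leader has chosen. -/
theorem exists_next_decision (htimeout : Tendsto F.timeout atTop atTop) {b : Block}
    (hbd : b = [] ∨ ∃ v, ρ.Certified F i Phase.commit v b) (T : ℕ) :
    ∃ t > T, ∃ p ∈ F.honestMembers i, ∃ qc, ρ.Decides F t p qc ∧ b.length < qc.block.length ∧
      ∃ c, b <:+ c ∧ IsLegalBranch c ∧
        ∃ L R U s, F.IsLeaderChoice L R U s c qc.block := by
  obtain ⟨Tf, hTf⟩ := exists_fresh_known hb hN hT hwork b
  obtain ⟨L, hL, -⟩ := hN.isQuorum.exists_honest hN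
  have hL' := FlowSystem.honest_of_mem hL
  obtain ⟨v₀, hv₀⟩ : ∃ v₀, b = [] ∨ ρ.Certified F i Phase.commit v₀ b := by
    rcases hbd with h | ⟨v, h⟩
    · exact ⟨0, Or.inl h⟩
    · exact ⟨v, Or.inr h⟩
  -- The view is taken beyond `v₀`, so that the leader builds on `b`, and beyond the view of `L` at
  -- tick `Tf`, so that `L` proposes when it already knows a transaction absent from `b`.
  obtain ⟨N, hev⟩ := eventually_atTop.1
    ((eventually_exists_decides hphys hb hu hN hT htimeout T).and
    ((eventually_gt_atTop v₀).and (eventually_gt_atTop (ρ.state Tf L).view)))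
  obtain ⟨v, hvN, hlead⟩ := FlowSystem.exists_leader_ge (Finset.mem_inter.1 hL).1 N
  obtain ⟨h1, h2, h3⟩ := hev v hvN
  obtain ⟨t, ht, p, hp, qc, hdec, rfl⟩ := h1 L hL hlead
  have hcert := hdec.certified hphys hb hu hp
  obtain ⟨r, hr, t', q', hm⟩ := hcert.exists_vote hN
  obtain ⟨s, q, hq, hprop⟩ := exists_sent_proposal_of_vote hphys hb hu hN hlead hr hm
  obtain ⟨s₁, vote, k, B, hs⟩ := hb.takesStep_of_mem_sent hL' hprop
  obtain ⟨h4, -, ⟨-, -, hhigh, hchoice⟩, -⟩ := hs.of_sent_proposal hprop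
  obtain ⟨-, ⟨r', -, hrec, hvalid, hphase, -⟩, -⟩ := id hhigh
  rw [FlowSystem.cluster_eq_of_mem hL] at hvalid
  have hqc := (signed_of_received hphys hb hu hrec rfl).eq_genesis_or_certified hvalid
  rw [hphase] at hqc
  have hsuf : b <:+ hq.block := by
    rcases hv₀ with rfl | hv₀
    · exact List.nil_suffix
    · have h5 := hv₀.preCommit hphys hb hu hN
      have h6 := le_view_of_isHighQC hphys hb hN hL h5 (by rw [hs.mid_view]; omega) hhigh
      have h7 := h5.view_pos hb hN
      refine hv₀.suffix hphys hb hu hN h6 (hqc.resolve_left fun h => ?_)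
      rw [h] at h6
      simp only [QC.genesis] at h6
      omega
  have hlegal : IsLegalBranch hq.block := by
    rcases hqc with h | h
    · rw [h]
      trivial
    · exact h.isLegalBranch hphys hb hu hN
  refine ⟨t, ht, p, hp, qc, hdec, ?_, hq.block, hsuf, hlegal, L, _, _, s₁, hchoice⟩
  have hlen := hsuf.length_le
  rcases hchoice with ⟨-, h⟩ | ⟨-, l, -, h⟩ | ⟨-, h5, h⟩
  · rw [h, List.length_cons]
    omega
  · rw [h, List.length_cons]
    omega
  -- Resuming is allowed only if no append is acceptable. If the resumed block were `b` itself, the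
  -- fresh transaction would give an acceptable append.
  · rw [h]
    refine lt_of_le_of_ne hlen fun h6 => h5 ?_
    have h7 := hsuf.eq_of_length h6
    have h8 : Tf ≤ s := by
      by_contra hlt
      have := view_mono hb hL' (show s ≤ Tf by omega)
      simp only at this
      omega
    obtain ⟨x, hx, hnew⟩ := hTf s h8 L hL
    refine ⟨[F.txHash x], by simp, by simp, fun h hh => ?_, fun h hh => ⟨x, hx, ?_⟩⟩
    · rw [List.mem_singleton.1 hh, ← h7]
      exact hnew
    · exact (List.mem_singleton.1 hh).symm

theorem exists_long_extension (htimeout : Tendsto F.timeout atTop atTop) {b : Block}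
    (hbd : b = [] ∨ ∃ v, ρ.Certified F i Phase.commit v b) (m : ℕ) :
    ∃ b', (b' = [] ∨ ∃ v, ρ.Certified F i Phase.commit v b') ∧ b <:+ b' ∧
      b.length + m ≤ b'.length := by
  induction m with
  | zero => exact ⟨b, hbd, List.suffix_refl b, le_rfl⟩
  | succ m ih =>
    obtain ⟨b', h1, h2, h3⟩ := ih
    obtain ⟨t, -, p, hp, qc, h4, h5, c, h6, -, L, R, U, s, h7⟩ :=
      exists_next_decision hphys hb hu hN hT hwork htimeout h1 0
    exact ⟨qc.block, Or.inr ⟨_, h4.certified hphys hb hu hp⟩, h2.trans (h6.trans h7.suffix),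
      by omega⟩

/-- Extend the branch by more commands than the size threshold. Unless a collection is closed on the
way, the open one has then reached the threshold, and the next honest leader must close it. -/
theorem exists_many_closed (htimeout : Tendsto F.timeout atTop atTop) (K : ℕ) :
    ∃ b, (b = [] ∨ ∃ v, ρ.Certified F i Phase.commit v b) ∧
      K ≤ (closedCollections b).length := by
  induction K with
  | zero => exact ⟨[], Or.inl rfl, Nat.zero_le _⟩
  | succ K ih =>
    obtain ⟨b, hbd, hK⟩ := ih
    obtain ⟨b', h1, h2, h3⟩ := exists_long_extension hphys hb hu hN hT hwork htimeout hbd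
      -- The extra command makes the open collection non-empty even for threshold `0`.
      (F.sizeThreshold + 1)
    obtain ⟨t, -, p, hp, qc, h4, -, c, h6, h7, L, R, U, s, h8⟩ :=
      exists_next_decision hphys hb hu hN hT hwork htimeout h1 0
    refine ⟨qc.block, Or.inr ⟨_, h4.certified hphys hb hu hp⟩, ?_⟩
    by_contra hlt
    have h9 := length_closedCollections_le h8.suffix
    have h10 := h7.length_openCollection_le (h2.trans h6) (by omega)
    have h11 := h6.length_le
    have hclose : F.ShouldClose s c := by
      refine ⟨fun h => ?_, Or.inl (by omega)⟩
      rw [h, List.length_nil] at h10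
      omega
    rcases h8 with ⟨-, h⟩ | ⟨h, -⟩ | ⟨h, -⟩
    · have h12 := length_closedCollections_le (h2.trans h6)
      rw [h] at hlt
      simp only [closedCollections, List.length_cons] at hlt
      omega
    · exact h hclose
    · exact h hclose

theorem exists_decides_many_closed (htimeout : Tendsto F.timeout atTop atTop) (T K : ℕ) :
    ∃ t > T, ∃ p ∈ F.honestMembers i, ∃ qc, ρ.Decides F t p qc ∧
      K ≤ (closedCollections qc.block).length := by
  obtain ⟨b, hbd, hK⟩ := exists_many_closed hphys hb hu hN hT hwork htimeout K
  obtain ⟨t, ht, p, hp, qc, h4, -, c, h6, -, L, R, U, s, h8⟩ :=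
    exists_next_decision hphys hb hu hN hT hwork htimeout hbd T
  exact ⟨t, ht, p, hp, qc, h4, hK.trans (length_closedCollections_le (h6.trans h8.suffix))⟩

omit hN hT hwork hphys hu in
-- Only a decision submits, and it puts the submitted collection into the log. So whatever is formed
-- up to `T` appears in some log by tick `T + 1`.
theorem FormsAt.mem_log {t : ℕ} {C : List ℕ} (h : ρ.FormsAt F t i C) :
    ∃ p, C ∈ closedCollections (ρ.state (t + 1) p).log := by
  obtain ⟨p, hp, g, hg, rfl, -⟩ := h
  refine ⟨p, ?_⟩
  rcases hb.step_or_idle (FlowSystem.honest_of_mem hp) t with ⟨_, _, _, _, hs⟩ | ⟨-, -, h⟩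
  · rcases hs.cases_decides with ⟨qc, h⟩ | ⟨-, h, -⟩
    · rw [h.submitted] at hg
      rw [h.log]
      exact hg.1
    · rw [h] at hg
      exact hg.elim
  · rw [h] at hg
    exact hg.elim

/-- A non-Byzantine cluster forms new collections forever. -/
theorem exists_formsAt (htimeout : Tendsto F.timeout atTop atTop) (T : ℕ) :
    ∃ t > T, ∃ C, ρ.FormsAt F t i C ∧ ∀ t' ≤ T, ¬ ρ.FormsAt F t' i C := by
  classical
  -- All collections in any log at ticks up to `T + 1`: a finite set containing everything formed up
  -- to `T`.
  let S : Finset (List ℕ) := (Finset.range (T + 2)).biUnion fun t =>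
    Finset.univ.biUnion fun p => (closedCollections (ρ.state t p).log).toFinset
  have hS : ∀ t < T + 2, ∀ p, ∀ C ∈ closedCollections (ρ.state t p).log, C ∈ S := by
    intro t ht p C hC
    simp only [S, Finset.mem_biUnion, Finset.mem_range, Finset.mem_univ, true_and,
      List.mem_toFinset]
    exact ⟨t, ht, p, hC⟩
  have hlegal : ∀ {t p qc}, p ∈ F.honestMembers i → ρ.Decides F t p qc →
      IsLegalBranch qc.block := fun hp h =>
    (((h.certified hphys hb hu hp).preCommit hphys hb hu hN).prepare hphys hb hu
      hN).isLegalBranch hphys hb hu hN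
  have hex : ∃ t, T < t ∧ ∃ p ∈ F.honestMembers i, ∃ qc, ρ.Decides F t p qc ∧
      ∃ C ∈ closedCollections qc.block, C ∉ S := by
    obtain ⟨t, ht, p, hp, qc, hdec, hlen⟩ :=
      exists_decides_many_closed hphys hb hu hN hT hwork htimeout T (S.card + 1)
    refine ⟨t, ht, p, hp, qc, hdec, ?_⟩
    by_contra! hno
    have h1 : (closedCollections qc.block).toFinset ⊆ S := fun C hC =>
      hno C (List.mem_toFinset.1 hC)
    have h2 := Finset.card_le_card h1
    rw [List.toFinset_card_of_nodup (hlegal hp hdec).nodup_closedCollections] at h2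
    omega
  obtain ⟨hlt, p, hp, qc, hdec, C, hC, hCS⟩ := Nat.find_spec hex
  -- At the earliest honest decision after `T` of a branch with a collection outside `S`, the
  -- deciding node still has only collections from `S` in its log, so it submits the new one.
  set t := Nat.find hex with ht
  have hp' := FlowSystem.honest_of_mem hp
  have hlog : ∀ s, T + 1 ≤ s → s ≤ t → ∀ D ∈ closedCollections (ρ.state s p).log, D ∈ S := by
    intro s hs
    induction s, hs using Nat.le_induction with
    | base => exact fun _ => hS _ (by omega) p
    | succ s hs ih =>
      intro hst
      rcases hb.step_or_idle hp' s with ⟨_, _, _, _, hstep⟩ | ⟨h, -⟩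
      · rcases hstep.cases_decides with ⟨qc', h⟩ | ⟨h, -⟩
        · intro D hD
          by_contra hDS
          rw [h.log] at hD
          exact Nat.find_min hex (show s < Nat.find hex by omega)
            ⟨by omega, p, hp, qc', h, D, hD, hDS⟩
        · rw [h]
          exact ih (by omega)
      · rw [h]
        exact ih (by omega)
  refine ⟨t, hlt, C, ⟨p, hp, ⟨C, i, qc.signers⟩, ?_, rfl, rfl, ?_, hdec.isQuorum hp⟩, ?_⟩
  · rw [hdec.submitted]
    exact ⟨hC, fun h => hCS (hlog t hlt le_rfl C h), (FlowSystem.cluster_eq_of_mem hp).symm, rfl⟩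
  · exact (hlegal hp hdec).ne_nil_of_mem_closedCollections C hC
  · intro t' ht' h
    obtain ⟨p', h'⟩ := h.mem_log hb
    exact hCS (hS (t' + 1) (by omega) p' C h')

end Progress

/-- Liveness of a single run. -/
theorem alwaysProgresses (hclusters : 0 < F.clusters) (htimeout : Tendsto F.timeout atTop atTop)
    (hhonest : 2 * F.stakeOf Finset.univ < 3 * F.stakeOf F.honest) {Δ Φ : ℕ}
    (hphys : ρ.Physical) (hb : ρ.HonestBehavior F) (hu : ρ.Unforgeable F)
    (hsync : ρ.PartiallySynchronous F Δ Φ) (hwork : ρ.KeepsSubmitting F)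
    (hd : ρ.AllDelivered F) : ρ.AlwaysProgresses F := by
  obtain ⟨i, hi, hN⟩ := FlowSystem.exists_nonByzantine hclusters hhonest
  obtain ⟨gst, hT⟩ := hsync.exists_timely hd
  intro T
  obtain ⟨t, ht, C, h⟩ := exists_formsAt hphys hb hu hN hT hwork htimeout T
  exact ⟨t, ht, i, hi, C, h⟩

end Run

theorem mainTheorem1 {n : ℕ} (F : FlowSystem n)
    (hclusters : 0 < F.clusters)
    -- the time-outs of the pacemaker grow without bound
    (htimeout : Tendsto F.timeout atTop atTop)
    -- equally staked Collector Nodes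
    (hstake : ∀ p q, F.stake p = F.stake q)
    -- more than 2/3 of the stake is controlled by honest nodes
    (hhonest : 2 * F.stakeOf Finset.univ < 3 * F.stakeOf F.honest)
    (Δ Φ : ℕ)
    {Ω : Type*} [MeasurableSpace Ω] (μ : Measure Ω) [IsProbabilityMeasure μ]
    (run : Ω → Run n)
    (hrun : ∀ᵐ ω ∂μ, (run ω).Physical ∧ (run ω).HonestBehavior F ∧ (run ω).Unforgeable F ∧
      (run ω).PartiallySynchronous F Δ Φ ∧ (run ω).KeepsSubmitting F)
    (ε : ℝ≥0∞)
    -- message delivery with probability at least 1 - ε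
    (hdelivery : μ {ω | ¬ (run ω).AllDelivered F} ≤ ε) :
    μ {ω | ¬ (run ω).AlwaysProgresses F} ≤ ε := by
  -- Almost surely, a run without progress has lost a message between honest nodes. Monotonicity
  -- holds for the outer measure, so neither event has to be measurable.
  refine le_trans (measure_mono_ae ?_) hdelivery
  filter_upwards [hrun] with ω ⟨hphys, hb, hu, hsync, hwork⟩ hprog hd
  exact hprog (Run.alwaysProgresses hclusters htimeout hhonest hphys hb hu hsync hwork hd)
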